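/- Let $\mathcal B$ be a locally finitely presentable category (the category of set-valued models of a finite limit theory $\mathbb T$, whose syntactic category is $\mathcal B_{fp}^{op}$, where $\mathcal B_{fp}$ is the full subcategory of finitely presented objects). A *geometry* on $\mathcal B$ consists of - a *saturated class* $\mathcal V$: a class of maps between finitely presented objects of $\mathcal B$ which contains the isomorphisms between such objects, is closed under composition, under pushout along arbitrary maps of $\mathcal B_{fp}$ and under finite colimits in the category of arrows of $\mathcal B$, and is right-cancellative ($l\in\mathcal V$ and $fl\in\mathcal V$ imply $f\in\mathcal V$); - a Grothendieck topology $J$ on $\mathcal B_{fp}^{op}$ whose covers are generated by duals of maps in $\mathcal V$, i.e. every covering sieve contains a covering sieve generated by duals of maps in $\mathcal V$. For an object $B$, let $\mathcal V_B$ be the full subcategory of the coslice $B\downarrow\mathcal B$ on the *finitely presented etale arrows* under $B$, i.e. the arrows $n:B\to C$ that are the pushout of some $l:K\to K'$ in $\mathcal V$ along some $a:K\to B$. Let $J_B$ be the Grothendieck topology on $\mathcal V_B^{op}$ generated by the duals of the families $(m_i:n\to n_i)_{i\in I}$ in $\mathcal V_B$, with $n:B\to C$ and $n_i:B\to C_i$,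 for which there are $b:K\to C$ and a family $(l_i:K\to K_i)_{i\in I}$ in $\mathcal B_{fp}$ dual to a $J$-covering family such that each $m_i$ is the pushout of $l_i$ along $b$. Put $$\mathrm{Spec}(B)=\mathrm{Sh}(\mathcal V_B^{op},J_B),\qquad \iota_B:\mathrm{Spec}(B)\hookrightarrow\widehat{\mathcal V_B^{op}},$$ where $\widehat{\mathcal V_B^{op}}=[\mathcal V_B,\mathbf{Set}]$ and $\iota_B$ is the geometric morphism whose inverse image is the sheafification functor $\mathfrak a_{J_B}$. For $n\in\mathcal V_B$ write $y^*_n=\mathcal V_B(n,-)\in\widehat{\mathcal V_B^{op}}$. For $f:B_1\to B_2$, the inverse image part of $\mathrm{Spec}(f):\mathrm{Spec}(B_2)\to\mathrm{Spec}(B_1)$ is the left Kan extension, along $\mathfrak a_{J_{B_1}}y^*:\mathcal V_{B_1}^{op}\to\mathrm{Spec}(B_1)$, of the pushout functor $f_*:\mathcal V_{B_1}^{op}\to\mathcal V_{B_2}^{op}$ followed by $\mathfrak a_{J_{B_2}}y^*:\mathcal V_{B_2}^{op}\to\mathrm{Spec}(B_2)$. **Proposition.** Let $n:B\to C$ be a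 finitely presented etale arrow under $B$. Then the above left Kan extension for $f=n$ is the inverse image part of a geometric morphism $\mathrm{Spec}(n):\mathrm{Spec}(C)\to\mathrm{Spec}(B)$, and there is an equivalence $$\mathrm{Spec}(C)\simeq\mathrm{Spec}(B)/\mathfrak a_{J_B}(y^*_n)$$ which identifies $\mathrm{Spec}(n)$, up to isomorphism, with the canonical geometric morphism $\mathrm{Spec}(B)/\mathfrak a_{J_B}(y^*_n)\to\mathrm{Spec}(B)$ (with inverse image $A\mapsto (\mathfrak a_{J_B}(y^*_n)\times A\to \mathfrak a_{J_B}(y^*_n))$); in particular $\mathrm{Spec}(n)$ is an etale geometric morphism. Moreover the slices below are Grothendieck toposes and there is a $2$-pullback square in the bicategory of Grothendieck toposes $$\begin{array}{ccc}\mathrm{Spec}(B)/\mathfrak a_{J_B}(y^*_n)&\longrightarrow&\widehat{\mathcal V_B^{op}}/y^*_n\\ \downarrow&&\downarrow\\ \mathrm{Spec}(B)&\overset{\iota_B}{\longrightarrow}&\widehat{\mathcal V_B^{op}}\end{array}$$ whose vertical arrows are the canonical etale geometric morphisms and whose top arrow has as inverse image the functor $(P\to y^*_n)\mapsto(\mathfrak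 a_{J_B}P\to\mathfrak a_{J_B}(y^*_n))$ induced by $\mathfrak a_{J_B}$. Through the equivalence above, this exhibits $\mathrm{Spec}(n):\mathrm{Spec}(C)\to\mathrm{Spec}(B)$ as the $2$-pullback along $\iota_B$ of the canonical etale geometric morphism $\widehat{\mathcal V_B^{op}}/y^*_n\to\widehat{\mathcal V_B^{op}}$. -/

import Mathlib

open CategoryTheory CategoryTheory.Limits Opposite

universe w v₁ v₂ v₃ v₄ v u₁ u₂ u₃ u₄ u

noncomputable section

/-! ## Grothendieck toposes and geometric morphisms -/

/-- A Grothendieck topos (relative to the universe `w` of sets): a category equivalent to the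
category of sheaves of sets on a small site. -/
class IsGrothendieckTopos.{w', v', u'} (E : Type u') [Category.{v'} E] : Prop where
  exists_site : ∃ (C : Type w') (_ : SmallCategory.{w'} C) (J : GrothendieckTopology C),
    Nonempty (E ≌ Sheaf J (Type w'))

/-- A geometric morphism `E ⟶ F`: an adjunction `f^* ⊣ f_*` with `f_* : E ⥤ F` and `f^*` preserving
finite limits. -/
structure GeometricMorphism (E : Type u₁) [Category.{v₁} E] (F : Type u₂) [Category.{v₂} F] where
  inverse : F ⥤ E
  direct : E ⥤ F
  adj : inverse ⊣ direct
  preservesFiniteLimits : PreservesFiniteLimits inverse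

namespace GeometricMorphism

section

variable {E : Type u₁} [Category.{v₁} E] {F : Type u₂} [Category.{v₂} F]
  {G : Type u₃} [Category.{v₃} G] {H : Type u₄} [Category.{v₄} H]

/-- The `2`-cells `f ⟹ g` are the natural transformations `f^* ⟹ g^*`. -/
instance : Category (GeometricMorphism E F) :=
  inferInstanceAs (Category (InducedCategory (F ⥤ E) GeometricMorphism.inverse))

/-- The `2`-cell given by a natural transformation of inverse images. -/
def homMk {f g : GeometricMorphism E F} (α : f.inverse ⟶ g.inverse) : f ⟶ g :=
  InducedCategory.homMk α

/-- The natural transformation of inverse images underlying a `2`-cell. -/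
def app {f g : GeometricMorphism E F} (α : f ⟶ g) : f.inverse ⟶ g.inverse :=
  InducedCategory.Hom.hom α

@[ext]
theorem hom_ext {f g : GeometricMorphism E F} {α β : f ⟶ g} (h : app α = app β) : α = β :=
  InducedCategory.hom_ext h

@[simp]
theorem app_homMk {f g : GeometricMorphism E F} (α : f.inverse ⟶ g.inverse) :
    app (homMk α) = α := rfl

@[simp]
theorem app_id (f : GeometricMorphism E F) : app (𝟙 f) = 𝟙 f.inverse := rfl

@[simp]
theorem app_comp {f g h : GeometricMorphism E F} (α : f ⟶ g) (β : g ⟶ h) :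
    app (α ≫ β) = app α ≫ app β := rfl

/-- The invertible `2`-cell given by a natural isomorphism of inverse images. -/
def isoMk {f g : GeometricMorphism E F} (α : f.inverse ≅ g.inverse) : f ≅ g :=
  InducedCategory.isoMk α

/-- The composite of `f : E ⟶ F` and `g : F ⟶ G`. -/
def comp (f : GeometricMorphism E F) (g : GeometricMorphism F G) : GeometricMorphism E G where
  inverse := g.inverse ⋙ f.inverse
  direct := f.direct ⋙ g.direct
  adj := g.adj.comp f.adj
  preservesFiniteLimits :=
    haveI := f.preservesFiniteLimits
    haveI := g.preservesFiniteLimits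
    comp_preservesFiniteLimits _ _

/-- Composition with a fixed geometric morphism `g : F ⟶ G`, as a functor
`Geom[E, F] ⥤ Geom[E, G]`. -/
def postcomp (E : Type u₁) [Category.{v₁} E] (g : GeometricMorphism F G) :
    GeometricMorphism E F ⥤ GeometricMorphism E G where
  obj f := f.comp g
  map α := homMk (Functor.whiskerLeft g.inverse (app α))
  map_id _ := by ext : 1; exact Functor.whiskerLeft_id' _
  map_comp _ _ := by ext : 1; exact Functor.whiskerLeft_comp _ _ _

/-- Composition with a fixed geometric morphism `f : E ⟶ F`, as a functor
`Geom[F, G] ⥤ Geom[E, G]`. -/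
def precomp (f : GeometricMorphism E F) (G : Type u₃) [Category.{v₃} G] :
    GeometricMorphism F G ⥤ GeometricMorphism E G where
  obj g := f.comp g
  map α := homMk (Functor.whiskerRight (app α) f.inverse)
  map_id _ := by ext : 1; exact Functor.whiskerRight_id' _
  map_comp _ _ := by ext : 1; exact Functor.whiskerRight_comp _ _ _

/-- The associativity isomorphism of the composition of geometric morphisms. -/
def assoc (f : GeometricMorphism E F) (g : GeometricMorphism F G) (h : GeometricMorphism G H) :
    (f.comp g).comp h ≅ f.comp (g.comp h) :=
  isoMk (Functor.associator h.inverse g.inverse f.inverse).symm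

/-- An equivalence of categories, seen as a geometric morphism. -/
def ofEquivalence (e : E ≌ F) : GeometricMorphism E F where
  inverse := e.inverse
  direct := e.functor
  adj := e.symm.toAdjunction
  preservesFiniteLimits := inferInstance

/-- The canonical geometric morphism `E / X ⟶ E`. Its inverse image sends `A` to the projection
`X × A ⟶ X`. -/
def etale [HasBinaryProducts E] (X : E) [(Over.star X).IsLeftAdjoint] :
    GeometricMorphism (Over X) E where
  inverse := Over.star X
  direct := (Over.star X).rightAdjoint
  adj := Adjunction.ofIsLeftAdjoint _
  preservesFiniteLimits :=
    haveI := (Over.forgetAdjStar X).rightAdjoint_preservesLimits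
    inferInstance

/-- A geometric morphism `f : E ⟶ F` is etale if it is equivalent, over `F`, to the canonical
geometric morphism `F / X ⟶ F` for some object `X` of `F`. -/
def IsEtale [HasBinaryProducts F] [∀ X : F, (Over.star X).IsLeftAdjoint]
    (f : GeometricMorphism E F) : Prop :=
  ∃ (X : F) (e : E ≌ Over X), Nonempty (f ≅ (ofEquivalence e).comp (etale X))

/-- If `F` preserves finite limits, then so does the functor it induces on slices. -/
theorem preservesFiniteLimits_post [HasFiniteLimits F] (L : F ⥤ E) [PreservesFiniteLimits L]
    (X : F) : PreservesFiniteLimits (Over.post (X := X) L) := by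
  have : PreservesLimit (Functor.empty.{0} (Over X)) (Over.post (X := X) L) :=
    preservesLimit_of_preserves_limit_cone (Over.mkIdTerminal (X := X)) <| by
      refine (IsLimit.equivOfNatIsoOfIso (Functor.emptyExt _ _) _ _ ?_).toFun
        (Over.mkIdTerminal (X := L.obj X))
      exact Cone.ext (Over.isoMk (Iso.refl _) ((Category.id_comp _).trans (L.map_id X))) (by simp)
  have := preservesLimitsOfShape_pempty_of_preservesTerminal (Over.post (X := X) L)
  have : PreservesLimitsOfShape WalkingCospan (Over.post (X := X) L) := by
    have : PreservesLimitsOfShape WalkingCospan (Over.post (X := X) L ⋙ Over.forget _) :=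
      inferInstanceAs (PreservesLimitsOfShape WalkingCospan (Over.forget X ⋙ L))
    exact preservesLimitsOfShape_of_reflects_of_preserves _ (Over.forget (L.obj X))
  exact preservesFiniteLimits_of_preservesTerminal_and_pullbacks _

/-- The geometric morphism `E / f^* Y ⟶ F / Y` induced by a geometric morphism `f : E ⟶ F` and an
object `Y` of `F`. Its inverse image sends `A ⟶ Y` to `f^* A ⟶ f^* Y`. -/
def slice [HasFiniteLimits F] (f : GeometricMorphism E F) (Y : F) :
    GeometricMorphism (Over (f.inverse.obj Y)) (Over Y) where
  inverse := Over.post f.inverse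
  direct := Over.post f.direct ⋙ Over.pullback (f.adj.unit.app Y)
  adj := Over.postAdjunctionLeft f.adj
  preservesFiniteLimits :=
    haveI := f.preservesFiniteLimits
    preservesFiniteLimits_post _ _

end

section

variable {P : Type u₁} [Category.{v₁} P] {A : Type u₂} [Category.{v₂} A]
  {B : Type u₃} [Category.{v₃} B] {D : Type u₄} [Category.{v₄} D]

/-- The comparison functor from `Geom[E, P]` to the pseudopullback of the categories `Geom[E, A]`
and `Geom[E, B]` over `Geom[E, D]`, for a square that commutes up to an invertible `2`-cell. -/
def comparison {p : GeometricMorphism P A} {q : GeometricMorphism P B}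
    {f : GeometricMorphism A D} {g : GeometricMorphism B D} (α : p.comp f ≅ q.comp g)
    (E : Type u) [Category.{v} E] :
    GeometricMorphism E P ⥤ CategoricalPullback (postcomp E f) (postcomp E g) where
  obj x :=
    { fst := x.comp p
      snd := x.comp q
      iso := assoc x p f ≪≫ (precomp x D).mapIso α ≪≫ (assoc x q g).symm }
  map {x y} β :=
    { fst := (postcomp E p).map β
      snd := (postcomp E q).map β
      w := hom_ext <| NatTrans.ext <| funext fun d => by
        have h := (app β).naturality ((app α.hom).app d)
        change (app β).app _ ≫ 𝟙 _ ≫ y.inverse.map ((app α.hom).app d) ≫ 𝟙 _ =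
          (𝟙 _ ≫ x.inverse.map ((app α.hom).app d) ≫ 𝟙 _) ≫ (app β).app _
        simp [h] }
  map_id x := by
    apply CategoricalPullback.Hom.ext
    · exact (postcomp E p).map_id x
    · exact (postcomp E q).map_id x
  map_comp β γ := by
    apply CategoricalPullback.Hom.ext
    · exact (postcomp E p).map_comp β γ
    · exact (postcomp E q).map_comp β γ

/-- The square
```
P --p--> A
|        |
q        f
v        v
B --g--> D
```
of geometric morphisms, which commutes up to the invertible `2`-cell `α`, is a `2`-pullback in the
bicategory of Grothendieck toposes. -/
def IsTwoPullback.{w', v', u', a₁, a₂, a₃, a₄, b₁, b₂, b₃, b₄}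
    {P : Type b₁} [Category.{a₁} P] {A : Type b₂} [Category.{a₂} A]
    {B : Type b₃} [Category.{a₃} B] {D : Type b₄} [Category.{a₄} D]
    {p : GeometricMorphism P A} {q : GeometricMorphism P B}
    {f : GeometricMorphism A D} {g : GeometricMorphism B D} (α : p.comp f ≅ q.comp g) : Prop :=
  ∀ (E : Type u') [Category.{v'} E] [IsGrothendieckTopos.{w'} E], (comparison α E).IsEquivalence

end

end GeometricMorphism

/-! ### Sheaves on an essentially small site -/

section

/-- In a cartesian closed category with finite limits, `A ↦ (X × A ⟶ X)` has a right adjoint. -/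
theorem star_isLeftAdjoint {E : Type u₁} [Category.{v₁} E] [CartesianMonoidalCategory E]
    [MonoidalClosed E] [HasFiniteLimits E] (X : E) : (Over.star X).IsLeftAdjoint := by
  let : BraidedCategory E := .ofCartesianMonoidalCategory
  let := ChosenPullbacksAlong.ofHasPullbacksAlong (curryRightUnitorHom X)
  have : (toOver X).IsLeftAdjoint := ⟨_, ⟨Over.toOverSectionsAdj X⟩⟩
  exact Functor.isLeftAdjoint_of_iso
    ((Over.forgetAdjStar X).rightAdjointUniq (forgetAdjToOver X)).symm

variable {C : Type u} [Category.{w} C] [EssentiallySmall.{w} C]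

theorem presheaf_star_isLeftAdjoint (X : Cᵒᵖ ⥤ Type w) : (Over.star X).IsLeftAdjoint :=
  letI : MonoidalClosed (Cᵒᵖ ⥤ Type w) := cartesianClosedOfEquiv (Functor.asEquivalence
    ((Functor.whiskeringLeft _ _ (Type w)).obj (equivSmallModel.{w} Cᵒᵖ).functor))
  star_isLeftAdjoint X

theorem presheaf_isGrothendieckTopos : IsGrothendieckTopos.{w} (Cᵒᵖ ⥤ Type w) where
  exists_site :=
    ⟨_, _, _, ⟨(equivSmallModel.{w} C).op.congrLeft.trans (sheafBotEquivalence _).symm⟩⟩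

variable (J : GrothendieckTopology C)

theorem hasSheafify_of_essentiallySmall : HasSheafify J (Type w) :=
  hasSheafifyEssentiallySmallSite.{w} J (Type w)

attribute [local instance] hasSheafify_of_essentiallySmall

theorem sheaf_star_isLeftAdjoint (X : Sheaf J (Type w)) : (Over.star X).IsLeftAdjoint :=
  letI : MonoidalClosed (Cᵒᵖ ⥤ Type w) := cartesianClosedOfEquiv (Functor.asEquivalence
    ((Functor.whiskeringLeft _ _ (Type w)).obj (equivSmallModel.{w} Cᵒᵖ).functor))
  @star_isLeftAdjoint _ _ _ (instMonoidalClosedSheafOfHasSheafifyOfFunctorOpposite J (Type w)) _ X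

/-- Sheaves on an essentially small site are sheaves on an equivalent small site. -/
def sheafEquivSmall :
    Sheaf J (Type w) ≌ Sheaf ((equivSmallModel.{w} C).inverse.inducedTopology J) (Type w) :=
  (equivSmallModel.{w} C).sheafCongr J _ (Type w)

theorem sheaf_isGrothendieckTopos : IsGrothendieckTopos.{w} (Sheaf J (Type w)) where
  exists_site := ⟨_, _, _, ⟨sheafEquivSmall J⟩⟩

theorem sheaf_locallySmall : LocallySmall.{w} (Sheaf J (Type w)) :=
  (locallySmall_congr (sheafEquivSmall J)).2 inferInstance

theorem sheaf_hasColimits : HasColimitsOfSize.{w, w} (Sheaf J (Type w)) :=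
  have : HasColimitsOfSize.{w, w}
      (Sheaf ((equivSmallModel.{w} C).inverse.inducedTopology J) (Type w)) :=
    hasColimits_of_reflective (sheafToPresheaf _ _)
  Adjunction.has_colimits_of_equivalence (sheafEquivSmall J).functor

/-- The inclusion `Sh(C, J) ⟶ PSh(C)` as a geometric morphism: the inverse image is
sheafification. -/
def sheafInclusion : GeometricMorphism (Sheaf J (Type w)) (Cᵒᵖ ⥤ Type w) where
  inverse := presheafToSheaf J (Type w)
  direct := sheafToPresheaf J (Type w)
  adj := sheafificationAdjunction J (Type w)
  preservesFiniteLimits := inferInstance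

end

/-! ## Geometries -/

section

variable (ℬ : Type u) [Category.{w} ℬ]

/-- The full subcategory of finitely presented objects. -/
abbrev FinPres : Type u := (ObjectProperty.isFinitelyPresentable.{w} ℬ).FullSubcategory

/-- A saturated class of maps of finite presentation in `ℬ`. -/
structure SaturatedClass where
  /-- the underlying class of maps -/
  maps : MorphismProperty ℬ
  source_mem {K K' : ℬ} (l : K ⟶ K') : maps l → IsFinitelyPresentable.{w} K
  target_mem {K K' : ℬ} (l : K ⟶ K') : maps l → IsFinitelyPresentable.{w} K'
  comp_mem {K K' K'' : ℬ} (l : K ⟶ K') (l' : K' ⟶ K'') : maps l → maps l' → maps (l ≫ l')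
  iso_mem {K K' : ℬ} (l : K ⟶ K') : IsFinitelyPresentable.{w} K → IsFinitelyPresentable.{w} K' →
    IsIso l → maps l
  /-- right cancellation -/
  cancel {K K' K'' : ℬ} (l : K ⟶ K') (f : K' ⟶ K'') : maps l → maps (l ≫ f) → maps f
  /-- closure under pushouts along maps of finite presentation -/
  pushout_mem {K K' L L' : ℬ} {l : K ⟶ K'} {k : K ⟶ L} {k' : K' ⟶ L'} {l' : L ⟶ L'} :
    IsPushout l k k' l' → IsFinitelyPresentable.{w} L → maps l → maps l'
  /-- closure under finite colimits in the category of arrows of `ℬ` -/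
  finiteColimits_mem (I : Type) [SmallCategory I] [FinCategory I] :
    maps.IsStableUnderColimitsOfShape I

/-- A geometry on `ℬ` (the category of set-valued models of a finite limit theory `𝕋`, the syntactic
category of `𝕋` being the opposite of the category of finitely presented objects of `ℬ`):
a saturated class `𝒱` and a Grothendieck topology `J` on the syntactic category whose covers are
generated by duals of maps in `𝒱`. -/
structure Geometry where
  𝒱 : SaturatedClass ℬ
  J : GrothendieckTopology (FinPres ℬ)ᵒᵖ
  generated (K : (FinPres ℬ)ᵒᵖ) (S : Sieve K) : S ∈ J K →
    ∃ R : Presieve K, (∀ ⦃L : (FinPres ℬ)ᵒᵖ⦄ (l : L ⟶ K), R l → 𝒱.maps l.unop.hom) ∧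
      Sieve.generate R ≤ S ∧ Sieve.generate R ∈ J K

end

namespace Geometry

variable {ℬ : Type u} [Category.{w} ℬ] (𝒢 : Geometry ℬ)

/-- An arrow `n : B ⟶ C` under `B` is a finitely presented etale arrow if it is a pushout
```
K --l--> K'
|        |
a        c
v        v
B --n--> C
```
of some map `l` in `𝒱`. -/
def IsFPEtale (B : ℬ) : ObjectProperty (Under B) := fun n =>
  ∃ (K K' : ℬ) (l : K ⟶ K') (a : K ⟶ B) (c : K' ⟶ n.right),
    𝒢.𝒱.maps l ∧ IsPushout l a c n.hom

/-- The etale generator `𝒱_B`: the full subcategory of `Under B` on the finitely presented etale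
arrows under `B`. -/
abbrev EtaleGenerator (B : ℬ) : Type (max u w) := (𝒢.IsFPEtale B).FullSubcategory

/-- The spectral site of `B` has underlying category `𝒱_B^op`. -/
abbrev Site (B : ℬ) : Type (max u w) := (𝒢.EtaleGenerator B)ᵒᵖ

/-- The families generating the topology `J_B` on `𝒱_B^op`: the duals of the families
`(m i : n ⟶ n' i)` in `𝒱_B`, with `n : B ⟶ C` and `n' i : B ⟶ C' i`, such that there are
`b : K ⟶ C` and a family `(l i : K ⟶ K' i)` dual to a covering family for `J`, each `m i` being the
pushout of `l i` along `b`. -/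
def coverings (B : ℬ) : Precoverage (𝒢.Site B) where
  coverings n := {R | ∃ (I : Type (max u w)) (n' : I → 𝒢.EtaleGenerator B)
    (m : ∀ i, n.unop ⟶ n' i) (K : FinPres ℬ) (K' : I → FinPres ℬ) (l : ∀ i, K ⟶ K' i)
    (b : K.obj ⟶ n.unop.obj.right) (b' : ∀ i, (K' i).obj ⟶ (n' i).obj.right),
    Sieve.generate (Presieve.ofArrows (fun i => op (K' i)) (fun i => (l i).op)) ∈ 𝒢.J (op K) ∧
    (∀ i, IsPushout (l i).hom b (b' i) (m i).hom.right) ∧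
    R = Presieve.ofArrows (fun i => op (n' i)) (fun i => (m i).op)}

/-- The Grothendieck topology `J_B` on `𝒱_B^op`. -/
def topology (B : ℬ) : GrothendieckTopology (𝒢.Site B) := (𝒢.coverings B).toGrothendieck

/-- The spectrum `Spec(B) = Sh(𝒱_B^op, J_B)`. -/
abbrev Spec (B : ℬ) : Type (max u (w + 1)) := Sheaf (𝒢.topology B) (Type w)

/-- The presheaf topos on `𝒱_B^op`. -/
abbrev PSh (B : ℬ) : Type (max u (w + 1)) := (𝒢.Site B)ᵒᵖ ⥤ Type w

variable [IsLocallyFinitelyPresentable.{w} ℬ]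

instance essentiallySmall_etaleGenerator (B : ℬ) : EssentiallySmall.{w} (𝒢.EtaleGenerator B) := by
  have : Fact (Cardinal.aleph0.{w}).IsRegular := ⟨Cardinal.isRegular_aleph0⟩
  have : ObjectProperty.EssentiallySmall.{w} (ObjectProperty.isFinitelyPresentable.{w} ℬ) :=
    inferInstanceAs (ObjectProperty.EssentiallySmall.{w}
      (isCardinalPresentable ℬ Cardinal.aleph0.{w}))
  obtain ⟨Q, _, hQ⟩ := ObjectProperty.EssentiallySmall.exists_small_le'.{w}
    (ObjectProperty.isFinitelyPresentable.{w} ℬ)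
  let φ : (Σ (K K' : Subtype Q), (K.1 ⟶ K'.1) × (K.1 ⟶ B)) → Under B :=
    fun x => Under.mk (pushout.inr x.2.2.1 x.2.2.2)
  have : ObjectProperty.EssentiallySmall.{w} (𝒢.IsFPEtale B) := by
    refine ⟨⟨ObjectProperty.ofObj φ, inferInstance, ?_⟩⟩
    rintro n ⟨K, K', l, a, c, hl, h⟩
    obtain ⟨K₀, hK₀, ⟨e⟩⟩ := hQ _ (𝒢.𝒱.source_mem l hl)
    obtain ⟨K₀', hK₀', ⟨e'⟩⟩ := hQ _ (𝒢.𝒱.target_mem l hl)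
    have h' : IsPushout (e.inv ≫ l ≫ e'.hom) (e.inv ≫ a) (e'.inv ≫ c) n.hom :=
      IsPushout.of_iso h e e' (Iso.refl _) (Iso.refl _) (by simp) (by simp) (by simp) (by simp)
    refine ⟨_, ⟨⟨⟨K₀, hK₀⟩, ⟨K₀', hK₀'⟩, e.inv ≫ l ≫ e'.hom, e.inv ≫ a⟩⟩, ⟨?_⟩⟩
    exact Under.isoMk h'.isoPushout (by simp [φ])
  infer_instance

instance (B : ℬ) : HasSheafify (𝒢.topology B) (Type w) := hasSheafify_of_essentiallySmall _

instance (B : ℬ) : LocallySmall.{w} (𝒢.Spec B) := sheaf_locallySmall _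

instance (B : ℬ) : HasColimitsOfSize.{w, w} (𝒢.Spec B) := sheaf_hasColimits _

instance (B : ℬ) : IsGrothendieckTopos.{w} (𝒢.Spec B) := sheaf_isGrothendieckTopos _

instance (B : ℬ) : IsGrothendieckTopos.{w} (𝒢.PSh B) := presheaf_isGrothendieckTopos

instance (B : ℬ) (X : 𝒢.Spec B) : (Over.star X).IsLeftAdjoint := sheaf_star_isLeftAdjoint _ X

instance (B : ℬ) (X : 𝒢.PSh B) : (Over.star X).IsLeftAdjoint := presheaf_star_isLeftAdjoint X

/-- The inclusion `ι_B : Spec(B) ⟶ PSh(𝒱_B^op)`; its inverse image is the sheafification functor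
`𝔞_{J_B}`. -/
def ι (B : ℬ) : GeometricMorphism (𝒢.Spec B) (𝒢.PSh B) := sheafInclusion (𝒢.topology B)

/-- The functor `𝒱_B^op ⥤ Spec(B)`, the Yoneda embedding followed by sheafification. -/
def generic (B : ℬ) : 𝒢.Site B ⥤ 𝒢.Spec B := yoneda ⋙ (𝒢.ι B).inverse

/-- The pushout functor `f_* : 𝒱_{B₁} ⥤ 𝒱_{B₂}` along `f : B₁ ⟶ B₂`. -/
def push {B₁ B₂ : ℬ} (f : B₁ ⟶ B₂) : 𝒢.EtaleGenerator B₁ ⥤ 𝒢.EtaleGenerator B₂ :=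
  ObjectProperty.lift _ ((𝒢.IsFPEtale B₁).ι ⋙ Under.pushout f) (by
    rintro ⟨n, K, K', l, a, c, hl, h⟩
    exact ⟨K, K', l, a ≫ f, c ≫ pushout.inl n.hom f, hl,
      h.paste_vert (IsPushout.of_hasPushout n.hom f)⟩)

instance {B₁ B₂ : ℬ} (F : 𝒢.Site B₁ ⥤ 𝒢.Spec B₂) :
    (𝒢.generic B₁).HasLeftKanExtension F := by
  have (Y : 𝒢.Spec B₁) : HasColimitsOfShape (CostructuredArrow (𝒢.generic B₁) Y) (𝒢.Spec B₂) :=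
    hasColimitsOfShape_of_essentiallySmall.{w} _ _
  have : (𝒢.generic B₁).HasPointwiseLeftKanExtension F := fun Y => inferInstance
  infer_instance

/-- The functor `Spec(B₁) ⥤ Spec(B₂)` which is the inverse image part of
`Spec(f) : Spec(B₂) ⟶ Spec(B₁)`, for `f : B₁ ⟶ B₂`: the left Kan extension along
`𝒱_{B₁}^op ⥤ Spec(B₁)` of `f_*` followed by `𝒱_{B₂}^op ⥤ Spec(B₂)`. -/
def specInverse {B₁ B₂ : ℬ} (f : B₁ ⟶ B₂) : 𝒢.Spec B₁ ⥤ 𝒢.Spec B₂ :=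
  (𝒢.generic B₁).leftKanExtension ((𝒢.push f).op ⋙ 𝒢.generic B₂)

/-- `g` is the geometric morphism `Spec(f) : Spec(B₂) ⟶ Spec(B₁)` (it is determined up to a
canonical isomorphism by its inverse image part). -/
def IsSpecMap {B₁ B₂ : ℬ} (f : B₁ ⟶ B₂) (g : GeometricMorphism (𝒢.Spec B₂) (𝒢.Spec B₁)) : Prop :=
  Nonempty (g.inverse ≅ 𝒢.specInverse f)

/-- The presheaf represented by an object `n` of `𝒱_B^op`. -/
def repr {B : ℬ} (n : 𝒢.EtaleGenerator B) : 𝒢.PSh B := yoneda.obj (op n)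

/-- The sheaf `𝔞_{J_B}` of the presheaf represented by `n`. -/
def sheafRepr {B : ℬ} (n : 𝒢.EtaleGenerator B) : 𝒢.Spec B := (𝒢.ι B).inverse.obj (𝒢.repr n)

end Geometry

end

/-!
For a geometric morphism `f : E ⟶ F` and `Y : F`, a left exact functor out of `F/Y` is determined by
its restriction along `Y ⨯ - : F ⥤ F/Y` together with the image of the diagonal, a generic section
of `Y ⨯ Y ⟶ Y`. So a geometric morphism `G ⟶ F/Y` is a geometric morphism `g : G ⟶ F` with a global
section of `g^* Y`, and when `g = f h` the latter is a section of `h^* (f^* Y)`: the square of the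
slices over `Y` and `f^* Y` is a 2-pullback.

Etale arrows compose, because a finitely presented object maps into a finite stage of a filtered
colimit, and they are right-cancellative. Hence precomposition with `n : B ⟶ C` identifies
`𝒱_C^op` with the slice of `𝒱_B^op` over `n`, and the topology `J_C` with the one induced by `J_B`.
The presheaves over a representable are the presheaves on this slice, and the sheaves over its
sheafification are the sheaves on it: both `Sh(𝒱_C^op, J_C)` and the slice of `Sh(𝒱_B^op, J_B)`
localize the same presheaf category at the same maps. Under this equivalence `A ↦ 𝔞(y^*_n) ⨯ A`
restricts along `𝔞 y^*` to the functor induced by pushout along `n`, so, being a left adjoint, it is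
the left Kan extension defining `Spec(n)`.
-/

noncomputable section

/-! ### Left exact functors on a slice category -/

section

variable {F : Type u₁} [Category.{v₁} F]

section

variable [HasBinaryProducts F] {Y : F}

/-- The unit `A ⟶ Y^* A` of the adjunction between `F / Y ⥤ F` and `Y^*`. -/
def starUnit (A : Over Y) : A ⟶ (Over.star Y).obj A.left :=
  (Over.forgetAdjStar Y).unit.app A

variable (Y) in
/-- The counit `Y ⨯ A ⟶ A` of the adjunction between `F / Y ⥤ F` and `Y^*`. -/
def starCounit (A : F) : ((Over.star Y).obj A).left ⟶ A :=
  (Over.forgetAdjStar Y).counit.app A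

variable (Y) in
/-- The diagonal of `Y`, as a global section of `Y^* Y` in `F / Y`. -/
def diagonalSection : Over.mk (𝟙 Y) ⟶ (Over.star Y).obj Y :=
  starUnit (Over.mk (𝟙 Y))

theorem starUnit_naturality {A B : Over Y} (f : A ⟶ B) :
    f ≫ starUnit B = starUnit A ≫ (Over.star Y).map f.left :=
  (Over.forgetAdjStar Y).unit.naturality f

theorem star_map_left_starCounit {A B : F} (f : A ⟶ B) :
    ((Over.star Y).map f).left ≫ starCounit Y B = starCounit Y A ≫ f :=
  (Over.forgetAdjStar Y).counit.naturality f

theorem starUnit_left_starCounit (A : Over Y) : (starUnit A).left ≫ starCounit Y A.left = 𝟙 _ :=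
  (Over.forgetAdjStar Y).left_triangle_components A

theorem starUnit_star_map_starCounit (A : F) :
    starUnit ((Over.star Y).obj A) ≫ (Over.star Y).map (starCounit Y A) = 𝟙 _ :=
  (Over.forgetAdjStar Y).right_triangle_components A

theorem star_hom_ext {A : F} {Z : Over Y} {f g : Z ⟶ (Over.star Y).obj A}
    (h : f.left ≫ starCounit Y A = g.left ≫ starCounit Y A) : f = g :=
  ((Over.forgetAdjStar Y).homEquiv _ _).symm.injective h

theorem isPullback_starUnit {A B : Over Y} (f : A ⟶ B) :
    IsPullback (starUnit A) f ((Over.star Y).map f.left) (starUnit B) := by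
  have hleft {Z : Over Y} (a : Z ⟶ (Over.star Y).obj A.left) (b : Z ⟶ B)
      (w : a ≫ (Over.star Y).map f.left = b ≫ starUnit B) :
      (a.left ≫ starCounit Y A.left) ≫ f.left = b.left := by
    have h := congr_arg (fun g => g.left ≫ starCounit Y B.left) w
    simpa only [Over.comp_left, Category.assoc, star_map_left_starCounit,
      reassoc_of% starUnit_left_starCounit A, starUnit_left_starCounit, Category.comp_id] using h
  refine ⟨⟨(starUnit_naturality f).symm⟩, ⟨PullbackCone.IsLimit.mk _
    (fun s => Over.homMk (s.fst.left ≫ starCounit Y A.left) ?_) (fun s => ?_) (fun s => ?_)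
    (fun s m hm _ => ?_)⟩⟩
  · rw [← Over.w f, ← Over.w s.snd, ← hleft _ _ s.condition]
    simp only [Category.assoc]
  · exact star_hom_ext (by simp only [Over.comp_left, Over.homMk_left, Category.assoc,
      starUnit_left_starCounit, Category.comp_id])
  · ext
    exact hleft _ _ s.condition
  · ext
    simp only [← hm, Over.comp_left, Over.homMk_left, Category.assoc, starUnit_left_starCounit,
      Category.comp_id]

end

variable [HasFiniteLimits F] {Y : F} {T : Type u₂} [Category.{v₂} T] {P Q : Over Y ⥤ T}
  [PreservesFiniteLimits Q]

theorem natTrans_ext_of_whiskerLeft_star {β β' : P ⟶ Q}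
    (h : Functor.whiskerLeft (Over.star Y) β = Functor.whiskerLeft (Over.star Y) β') :
    β = β' := by
  ext A
  apply ((isPullback_starUnit (Over.mkIdTerminal.from A)).map Q).hom_ext
  · rw [← β.naturality, ← β'.naturality]
    exact _ ≫= NatTrans.congr_app h A.left
  · exact (Over.mkIdTerminal.isTerminalObj Q _).hom_ext _ _

theorem exists_whiskerLeft_star_eq (γ : Over.star Y ⋙ P ⟶ Over.star Y ⋙ Q)
    (t : P.obj (Over.mk (𝟙 Y)) ⟶ Q.obj (Over.mk (𝟙 Y)))
    (ht : P.map (diagonalSection Y) ≫ γ.app Y = t ≫ Q.map (diagonalSection Y)) :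
    ∃ β : P ⟶ Q, Functor.whiskerLeft (Over.star Y) β = γ := by
  let γ' (A : F) : P.obj ((Over.star Y).obj A) ⟶ Q.obj ((Over.star Y).obj A) := γ.app A
  have hγ {A B : F} (f : A ⟶ B) :
      γ' A ≫ Q.map ((Over.star Y).map f) = P.map ((Over.star Y).map f) ≫ γ' B :=
    (γ.naturality f).symm
  have hQ (A : Over Y) : IsPullback (Q.map (starUnit A)) (Q.map (Over.mkIdTerminal.from A))
      (Q.map ((Over.star Y).map (Over.mkIdTerminal.from A).left)) (Q.map (diagonalSection Y)) :=
    (isPullback_starUnit (Over.mkIdTerminal.from A)).map Q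
  have hcomm (A : Over Y) :
      (P.map (starUnit A) ≫ γ' A.left) ≫ Q.map ((Over.star Y).map (Over.mkIdTerminal.from A).left) =
        (P.map (Over.mkIdTerminal.from A) ≫ t) ≫ Q.map (diagonalSection Y) := by
    rw [Category.assoc, hγ, ← P.map_comp_assoc, ← starUnit_naturality, P.map_comp_assoc,
      Category.assoc, ← ht]
    rfl
  let β (A : Over Y) : P.obj A ⟶ Q.obj A := (hQ A).lift _ _ (hcomm A)
  have hβ (A : Over Y) : β A ≫ Q.map (starUnit A) = P.map (starUnit A) ≫ γ' A.left :=
    (hQ A).lift_fst _ _ _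
  refine ⟨{ app := β, naturality A B f := (hQ B).hom_ext ?_ ?_ }, ?_⟩
  · rw [Category.assoc, hβ, ← P.map_comp_assoc, Category.assoc, ← Q.map_comp,
      starUnit_naturality, Q.map_comp, reassoc_of% (hβ A), hγ, P.map_comp_assoc]
  · exact (Over.mkIdTerminal.isTerminalObj Q _).hom_ext _ _
  · ext A
    have h := hβ ((Over.star Y).obj A) =≫ Q.map ((Over.star Y).map (starCounit Y A))
    rw [Category.assoc, Category.assoc, hγ, ← Q.map_comp, ← P.map_comp_assoc,
      starUnit_star_map_starCounit, Q.map_id, P.map_id, Category.comp_id, Category.id_comp] at h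
    exact h

end

section

variable {E : Type u₁} [Category.{v₁} E] {F : Type u₂} [Category.{v₂} F]
  [HasBinaryProducts E] [HasBinaryProducts F] (L : F ⥤ E)
  [PreservesLimitsOfShape (Discrete WalkingPair) L] (Y : F)

theorem starCounit_eq_snd (A : F) : starCounit Y A = (prod.snd : Y ⨯ A ⟶ A) :=
  Over.forgetAdjStar_counit_app Y A

theorem star_obj_hom_eq_fst (A : F) : ((Over.star Y).obj A).hom = (prod.fst : Y ⨯ A ⟶ Y) :=
  prod.lift_fst (prod.fst : Y ⨯ A ⟶ Y) (𝟙 _)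

/-- The canonical isomorphism `L (Y ⨯ A) ≅ L Y ⨯ L A` over `L Y`. -/
def starCompPostApp (A : F) :
    (Over.post L).obj ((Over.star Y).obj A) ≅ (Over.star (L.obj Y)).obj (L.obj A) :=
  Over.isoMk (PreservesLimitPair.iso L Y A) <|
    (_ ≫= star_obj_hom_eq_fst _ _).trans <| (prod.lift_fst _ _).trans <|
      congr_arg L.map (star_obj_hom_eq_fst Y A).symm

theorem starCompPostApp_hom_left_comp_starCounit (A : F) :
    (starCompPostApp L Y A).hom.left ≫ starCounit (L.obj Y) (L.obj A) = L.map (starCounit Y A) := by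
  rw [starCounit_eq_snd, starCounit_eq_snd]
  exact prod.lift_snd _ _

/-- A functor preserving binary products commutes with `A ↦ (Y ⨯ A ⟶ Y)`. -/
def starCompPostIso : Over.star Y ⋙ Over.post L ≅ L ⋙ Over.star (L.obj Y) :=
  NatIso.ofComponents (starCompPostApp L Y) fun {A B} f => star_hom_ext <| calc
    _ = ((Over.post L).map ((Over.star Y).map f)).left ≫ L.map (starCounit Y B) :=
      (Category.assoc _ _ _).trans (_ ≫= starCompPostApp_hom_left_comp_starCounit L Y B)
    _ = (starCompPostApp L Y A).hom.left ≫ starCounit (L.obj Y) (L.obj A) ≫ L.map f := by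
      rw [reassoc_of% starCompPostApp_hom_left_comp_starCounit]
      exact (L.map_comp _ _).symm.trans
        ((congr_arg L.map (star_map_left_starCounit f)).trans (L.map_comp _ _))
    _ = _ := by
      rw [← star_map_left_starCounit]
      exact (Category.assoc _ _ _).symm

variable {Y}

theorem post_map_starUnit_comp_starCompPostApp (A : Over Y) :
    (Over.post L).map (starUnit A) ≫ (starCompPostApp L Y A.left).hom =
      starUnit ((Over.post L).obj A) :=
  star_hom_ext <| by
    rw [Over.comp_left, Category.assoc, starCompPostApp_hom_left_comp_starCounit]
    refine (L.map_comp _ _).symm.trans ((congr_arg L.map (starUnit_left_starCounit A)).trans ?_)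
    exact (L.map_id _).trans (starUnit_left_starCounit ((Over.post L).obj A)).symm

/-- The canonical isomorphism between the terminal object of `E / L Y` and the image under `L` of
that of `F / Y`. -/
def mkIdIsoPost : Over.mk (𝟙 (L.obj Y)) ≅ (Over.post L).obj (Over.mk (𝟙 Y)) :=
  Over.isoMk (Iso.refl _) ((Category.id_comp _).trans (L.map_id Y))

theorem post_map_diagonalSection_comp_starCompPostApp :
    (Over.post L).map (diagonalSection Y) ≫ (starCompPostApp L Y Y).hom =
      (mkIdIsoPost L).inv ≫ diagonalSection (L.obj Y) := by
  refine Eq.trans ?_ (starUnit_naturality (mkIdIsoPost L).inv).symm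
  refine (post_map_starUnit_comp_starCompPostApp L (Over.mk (𝟙 Y))).trans ?_
  exact ((_ ≫= (Over.star (L.obj Y)).map_id _).trans (Category.comp_id _)).symm

end

/-! ### Geometric morphisms into a slice -/

namespace GeometricMorphism

section

variable {F : Type u₁} [Category.{v₁} F] [HasFiniteLimits F] {Y : F} [(Over.star Y).IsLeftAdjoint]
  {T : Type u₂} [Category.{v₂} T]

instance faithful_postcomp_etale : (postcomp T (etale Y)).Faithful where
  map_injective {_ y _ _} h :=
    haveI := y.preservesFiniteLimits
    hom_ext (natTrans_ext_of_whiskerLeft_star (congr_arg app h))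

/-- The section of `g^* Y` over the terminal object `x^* 1` that corresponds to a factorization up
to a `2`-cell of `g : T ⟶ F` through `F / Y ⟶ F`: the image of the diagonal of `Y`. -/
def inducedSection {x : GeometricMorphism T (Over Y)} {g : GeometricMorphism T F}
    (φ : x.comp (etale Y) ⟶ g) : x.inverse.obj (Over.mk (𝟙 Y)) ⟶ g.inverse.obj Y :=
  x.inverse.map (diagonalSection Y) ≫ (app φ).app Y

theorem inducedSection_id (x : GeometricMorphism T (Over Y)) :
    inducedSection (𝟙 (x.comp (etale Y))) = x.inverse.map (diagonalSection Y) :=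
  Category.comp_id _

theorem inducedSection_comp {x : GeometricMorphism T (Over Y)} {g h : GeometricMorphism T F}
    (φ : x.comp (etale Y) ⟶ g) (γ : g ⟶ h) :
    inducedSection (φ ≫ γ) = inducedSection φ ≫ (app γ).app Y :=
  (Category.assoc _ _ _).symm

theorem inducedSection_postcomp_map_comp {x y : GeometricMorphism T (Over Y)}
    {g : GeometricMorphism T F} (β : x ⟶ y) (φ : y.comp (etale Y) ⟶ g) :
    inducedSection ((postcomp T (etale Y)).map β ≫ φ) =
      (app β).app (Over.mk (𝟙 Y)) ≫ inducedSection φ :=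
  (Category.assoc _ _ _).symm.trans
    (((app β).naturality (diagonalSection Y) =≫ _).trans (Category.assoc _ _ _))

theorem exists_postcomp_etale_map_eq {x y : GeometricMorphism T (Over Y)}
    (γ : x.comp (etale Y) ⟶ y.comp (etale Y))
    (t : x.inverse.obj (Over.mk (𝟙 Y)) ⟶ y.inverse.obj (Over.mk (𝟙 Y)))
    (ht : inducedSection γ = t ≫ y.inverse.map (diagonalSection Y)) :
    ∃ β : x ⟶ y, (postcomp T (etale Y)).map β = γ := by
  have := y.preservesFiniteLimits
  obtain ⟨β, hβ⟩ := exists_whiskerLeft_star_eq (app γ) t ht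
  exact ⟨homMk β, hom_ext hβ⟩

theorem exists_postcomp_etale_mapIso_eq {x y : GeometricMorphism T (Over Y)}
    (γ : x.comp (etale Y) ≅ y.comp (etale Y))
    (t : x.inverse.obj (Over.mk (𝟙 Y)) ⟶ y.inverse.obj (Over.mk (𝟙 Y)))
    (ht : inducedSection γ.hom = t ≫ y.inverse.map (diagonalSection Y)) :
    ∃ β : x ≅ y, (postcomp T (etale Y)).mapIso β = γ := by
  have := x.preservesFiniteLimits
  have := y.preservesFiniteLimits
  let t' := (Over.mkIdTerminal.isTerminalObj x.inverse _).from (y.inverse.obj (Over.mk (𝟙 Y)))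
  have ht' : t' ≫ t = 𝟙 _ := (Over.mkIdTerminal.isTerminalObj y.inverse _).hom_ext _ _
  have hγ : inducedSection γ.inv = t' ≫ x.inverse.map (diagonalSection Y) := by
    have h : inducedSection γ.hom ≫ (app γ.inv).app Y = x.inverse.map (diagonalSection Y) := by
      rw [← inducedSection_comp, γ.hom_inv_id, inducedSection_id]
    rw [← h, ht]
    exact ((reassoc_of% ht') _).symm.trans (t' ≫= (Category.assoc _ _ _).symm)
  obtain ⟨β, hβ⟩ := exists_postcomp_etale_map_eq γ.hom t ht
  obtain ⟨β', hβ'⟩ := exists_postcomp_etale_map_eq γ.inv t' hγ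
  refine ⟨⟨β, β', (postcomp T (etale Y)).map_injective ?_,
    (postcomp T (etale Y)).map_injective ?_⟩, Iso.ext hβ⟩
  · rw [CategoryTheory.Functor.map_comp, CategoryTheory.Functor.map_id, hβ, hβ']
    exact γ.hom_inv_id
  · rw [CategoryTheory.Functor.map_comp, CategoryTheory.Functor.map_id, hβ, hβ']
    exact γ.inv_hom_id

end

section

variable {E : Type u₁} [Category.{v₁} E] {F : Type u₂} [Category.{v₂} F]
  [HasFiniteLimits E] [HasFiniteLimits F] (f : GeometricMorphism E F) (Y : F)
  [(Over.star Y).IsLeftAdjoint] [(Over.star (f.inverse.obj Y)).IsLeftAdjoint]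

/-- The square formed by `f : E ⟶ F` and the induced geometric morphism `E / f^* Y ⟶ F / Y`
commutes. -/
def sliceEtaleIso : (f.slice Y).comp (etale Y) ≅ (etale (f.inverse.obj Y)).comp f :=
  haveI := f.preservesFiniteLimits
  isoMk (starCompPostIso f.inverse Y)

variable {f Y} {T : Type u₃} [Category.{v₃} T]

theorem inducedSection_comparison {x : GeometricMorphism T (Over (f.inverse.obj Y))}
    {g : GeometricMorphism T E} (φ : x.comp (etale (f.inverse.obj Y)) ⟶ g) :
    inducedSection (((comparison (sliceEtaleIso f Y) T).obj x).iso.hom ≫ (postcomp T f).map φ) =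
      x.inverse.map (mkIdIsoPost f.inverse).inv ≫ inducedSection φ := by
  have := f.preservesFiniteLimits
  let σ := x.inverse.map (starCompPostApp f.inverse Y Y).hom
  let φY : x.inverse.obj ((Over.star (f.inverse.obj Y)).obj (f.inverse.obj Y)) ⟶
    g.inverse.obj (f.inverse.obj Y) := (app φ).app (f.inverse.obj Y)
  calc
    _ = x.inverse.map ((Over.post f.inverse).map (diagonalSection Y)) ≫
        (𝟙 _ ≫ σ ≫ 𝟙 _) ≫ φY := rfl
    _ = x.inverse.map ((Over.post f.inverse).map (diagonalSection Y) ≫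
        (starCompPostApp f.inverse Y Y).hom) ≫ φY := by
      rw [Category.comp_id, Category.id_comp, x.inverse.map_comp_assoc]
    _ = _ := by
      rw [post_map_diagonalSection_comp_starCompPostApp, x.inverse.map_comp_assoc]
      rfl

theorem inducedSection_comparison_iso (x : GeometricMorphism T (Over (f.inverse.obj Y))) :
    inducedSection ((comparison (sliceEtaleIso f Y) T).obj x).iso.hom =
      x.inverse.map (mkIdIsoPost f.inverse).inv ≫
        x.inverse.map (diagonalSection (f.inverse.obj Y)) := by
  refine (congr_arg inducedSection ?_).trans ((inducedSection_comparison (𝟙 _)).trans ?_)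
  · exact ((_ ≫= (postcomp T f).map_id _).trans (Category.comp_id _)).symm
  · exact _ ≫= inducedSection_id x

instance faithful_comparison_sliceEtaleIso : (comparison (sliceEtaleIso f Y) T).Faithful where
  map_injective h := (postcomp T (etale (f.inverse.obj Y))).map_injective
    (congr_arg CategoricalPullback.Hom.snd h)

instance full_comparison_sliceEtaleIso : (comparison (sliceEtaleIso f Y) T).Full where
  map_surjective {x y} m := by
    let snd : x.comp (etale (f.inverse.obj Y)) ⟶ y.comp (etale (f.inverse.obj Y)) := m.snd
    let m₁ : x.inverse.obj ((Over.post f.inverse).obj (Over.mk (𝟙 Y))) ⟶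
      y.inverse.obj ((Over.post f.inverse).obj (Over.mk (𝟙 Y))) := (app m.fst).app (Over.mk (𝟙 Y))
    have hsection : x.inverse.map (mkIdIsoPost f.inverse).inv ≫ inducedSection snd =
        m₁ ≫ y.inverse.map (mkIdIsoPost f.inverse).inv ≫
          y.inverse.map (diagonalSection (f.inverse.obj Y)) := by
      rw [← inducedSection_comparison, ← inducedSection_comparison_iso]
      exact (congr_arg inducedSection m.w).symm.trans (inducedSection_postcomp_map_comp _ _)
    obtain ⟨β, hβ⟩ := exists_postcomp_etale_map_eq snd
      (x.inverse.map (mkIdIsoPost f.inverse).hom ≫ m₁ ≫ y.inverse.map (mkIdIsoPost f.inverse).inv)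
      (((Iso.inv_comp_eq (x.inverse.mapIso (mkIdIsoPost f.inverse))).1 hsection).trans (by
        simp only [Functor.mapIso_hom, Category.assoc]; rfl))
    refine ⟨β, CategoricalPullback.Hom.ext ?_ hβ⟩
    apply (postcomp T (etale Y)).map_injective
    apply (cancel_mono ((comparison (sliceEtaleIso f Y) T).obj y).iso.hom).1
    refine (((comparison (sliceEtaleIso f Y) T).map β).w.trans ?_).trans m.w.symm
    exact _ ≫= congr_arg (postcomp T f).map hβ

theorem essSurj_comparison_sliceEtaleIso
    (H : ∀ (g : GeometricMorphism T E) {S : T} (_ : IsTerminal S)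
      (s : S ⟶ g.inverse.obj (f.inverse.obj Y)),
      ∃ (x : GeometricMorphism T (Over (f.inverse.obj Y)))
        (φ : x.comp (etale (f.inverse.obj Y)) ≅ g)
        (t : x.inverse.obj (Over.mk (𝟙 _)) ⟶ S), inducedSection φ.hom = t ≫ s) :
    (comparison (sliceEtaleIso f Y) T).EssSurj where
  mem_essImage := by
    rintro ⟨g₁, g₂, θ⟩
    have := g₁.preservesFiniteLimits
    let θ : g₁.comp (etale Y) ≅ g₂.comp f := θ
    obtain ⟨x, φ, t, h⟩ := H g₂ (Over.mkIdTerminal.isTerminalObj g₁.inverse _)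
      (inducedSection θ.hom)
    let ψ : (x.comp (f.slice Y)).comp (etale Y) ≅ g₁.comp (etale Y) :=
      ((comparison (sliceEtaleIso f Y) T).obj x).iso ≪≫ (postcomp T f).mapIso φ ≪≫ θ.symm
    let s : g₁.inverse.obj (Over.mk (𝟙 Y)) ⟶ g₂.inverse.obj (f.inverse.obj Y) :=
      inducedSection θ.hom
    let θ' : g₂.inverse.obj (f.inverse.obj Y) ⟶ g₁.inverse.obj ((Over.star Y).obj Y) :=
      (app θ.inv).app Y
    have hs : s ≫ θ' = g₁.inverse.map (diagonalSection Y) := by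
      rw [← inducedSection_id, ← θ.hom_inv_id]
      exact (inducedSection_comp θ.hom θ.inv).symm
    have hψ : inducedSection ψ.hom =
        (x.inverse.map (mkIdIsoPost f.inverse).inv ≫ t) ≫ g₁.inverse.map (diagonalSection Y) := by
      have h₁ : inducedSection ψ.hom =
          inducedSection (((comparison (sliceEtaleIso f Y) T).obj x).iso.hom ≫
            (postcomp T f).map φ.hom) ≫ θ' :=
        (congr_arg inducedSection (Category.assoc _ _ _).symm).trans (inducedSection_comp _ _)
      have h₂ : inducedSection φ.hom ≫ θ' = t ≫ g₁.inverse.map (diagonalSection Y) := by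
        rw [← hs]
        exact (h =≫ θ').trans (Category.assoc t s θ')
      refine h₁.trans ((inducedSection_comparison φ.hom =≫ θ').trans ?_)
      exact (Category.assoc _ _ _).trans ((_ ≫= h₂).trans (Category.assoc _ _ _).symm)
    obtain ⟨β, hβ⟩ := exists_postcomp_etale_mapIso_eq ψ _ hψ
    refine ⟨x, ⟨CategoricalPullback.mkIso β φ ?_⟩⟩
    refine (congr_arg Iso.hom hβ =≫ θ.hom).trans ?_
    refine (Category.assoc _ _ _).trans (_ ≫= (Category.assoc _ _ _).trans ?_)
    exact (_ ≫= θ.inv_hom_id).trans (Category.comp_id _)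

end

end GeometricMorphism

/-! ### Slices of Grothendieck toposes -/

section

variable {E : Type u₁} [Category.{v₁} E] {F : Type u₂} [Category.{v₂} F] [HasFiniteLimits F]
  {L : F ⥤ E} {R : E ⥤ F} (adj : L ⊣ R)

theorem isIso_postAdjunctionLeft_counit [PreservesFiniteLimits L] [R.Full] [R.Faithful] (X : F) :
    IsIso (Over.postAdjunctionLeft (X := X) adj).counit := by
  rw [NatTrans.isIso_iff_isIso_app]
  intro A
  have : IsIso (L.map (pullback.fst (R.map A.hom) (adj.unit.app X))) :=
    ((IsPullback.of_hasPullback (R.map A.hom) (adj.unit.app X)).map L).isIso_fst_of_isIso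
  have h : (Over.forget _).map ((Over.postAdjunctionLeft (X := X) adj).counit.app A) =
      L.map (pullback.fst (R.map A.hom) (adj.unit.app X)) ≫ adj.counit.app A.left :=
    Over.postAdjunctionLeft_counit_app_left adj A
  have : IsIso ((Over.forget _).map ((Over.postAdjunctionLeft adj).counit.app A)) := by
    rw [h]
    exact inferInstanceAs (IsIso (L.map (pullback.fst _ _) ≫ adj.counit.app A.left))
  exact isIso_of_reflects_iso _ (Over.forget _)

/-- The slice of a reflective subcategory over `L X` is reflective in the slice over `X`, when the
reflector `L` is left exact. -/
@[reducible]
def reflectiveOver [PreservesFiniteLimits L] [R.Full] [R.Faithful] (X : F) :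
    Reflective (Over.post R ⋙ Over.pullback (adj.unit.app X)) :=
  haveI := isIso_postAdjunctionLeft_counit adj X
  haveI h := (Over.postAdjunctionLeft (X := X) adj).fullyFaithfulROfIsIsoCounit
  { toFull := h.full
    toFaithful := h.faithful
    L := Over.post L
    adj := Over.postAdjunctionLeft adj }

include adj in
theorem isLocalization_overPost [PreservesFiniteLimits L] [R.Full] [R.Faithful] (X : F) :
    (Over.post (X := X) L).IsLocalization
      ((MorphismProperty.isomorphisms _).inverseImage (Over.post (X := X) L)) :=
  letI := reflectiveOver adj X
  (Over.postAdjunctionLeft adj).isLocalization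

end

/-- The property that every slice is cartesian closed. -/
def HasCartesianClosedSlices (E : Type u) [Category.{v} E] : Prop :=
  ∀ (X : E) [CartesianMonoidalCategory (Over X)], Nonempty (MonoidalClosed (Over X))

theorem hasCartesianClosedSlices_presheaf (C : Type w) [SmallCategory C] :
    HasCartesianClosedSlices (Cᵒᵖ ⥤ Type w) := fun X _ =>
  ⟨cartesianClosedOfEquiv (overEquivPresheafCostructuredArrow X).symm⟩

namespace HasCartesianClosedSlices

theorem of_equivalence {E : Type u₁} [Category.{v₁} E] {F : Type u₂} [Category.{v₂} F]
    [HasFiniteLimits F] (hF : HasCartesianClosedSlices F) (e : E ≌ F) :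
    HasCartesianClosedSlices E := fun X _ => by
  let : CartesianMonoidalCategory (Over (e.functor.obj X)) := .ofHasFiniteProducts
  obtain ⟨_⟩ := hF (e.functor.obj X)
  exact ⟨cartesianClosedOfEquiv (Over.postEquiv X e).symm⟩

theorem of_reflection {E : Type u₁} [Category.{v} E] [HasFiniteLimits E] {F : Type u₂}
    [Category.{v} F] [HasFiniteLimits F] (hF : HasCartesianClosedSlices F)
    {L : F ⥤ E} {R : E ⥤ F} (adj : L ⊣ R) [PreservesFiniteLimits L] [R.Full]
    [R.Faithful] : HasCartesianClosedSlices E := fun X _ => by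
  let : CartesianMonoidalCategory (Over (R.obj X)) := .ofHasFiniteProducts
  let : CartesianMonoidalCategory (Over (L.obj (R.obj X))) := .ofHasFiniteProducts
  obtain ⟨_⟩ := hF (R.obj X)
  let i : Over (L.obj (R.obj X)) ⥤ Over (R.obj X) := Over.post R ⋙ Over.pullback (adj.unit.app _)
  let : Reflective i := reflectiveOver adj (R.obj X)
  have : PreservesFiniteLimits (reflector i) :=
    GeometricMorphism.preservesFiniteLimits_post L (R.obj X)
  let : MonoidalClosed (Over (L.obj (R.obj X))) := cartesianClosedOfReflective i
  exact ⟨cartesianClosedOfEquiv (Over.mapIso (asIso (adj.counit.app X) : L.obj (R.obj X) ≅ X))⟩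

end HasCartesianClosedSlices

namespace IsGrothendieckTopos

variable {T : Type u} [Category.{v} T] [IsGrothendieckTopos.{w} T]

variable (T) in
theorem hasFiniteLimits : HasFiniteLimits T := by
  obtain ⟨C, _, J, ⟨e⟩⟩ := IsGrothendieckTopos.exists_site.{w} (E := T)
  exact ⟨fun I _ _ => Adjunction.hasLimitsOfShape_of_equivalence e.functor⟩

theorem hasCartesianClosedSlices : HasCartesianClosedSlices T := by
  obtain ⟨C, _, J, ⟨e⟩⟩ := IsGrothendieckTopos.exists_site.{w} (E := T)
  exact ((hasCartesianClosedSlices_presheaf C).of_reflection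
    (sheafificationAdjunction J (Type w))).of_equivalence e

theorem star_isLeftAdjoint [HasFiniteLimits T] (X : T) : (Over.star X).IsLeftAdjoint := by
  let : CartesianMonoidalCategory T := .ofHasFiniteProducts
  let : CartesianMonoidalCategory (Over (⊤_ T)) := .ofHasFiniteProducts
  obtain ⟨_⟩ := hasCartesianClosedSlices.{w} (⊤_ T)
  let : MonoidalClosed T := cartesianClosedOfEquiv (Over.equivalenceOfIsTerminal terminalIsTerminal)
  exact _root_.star_isLeftAdjoint X

theorem star_over_isLeftAdjoint [HasFiniteLimits T] {X : T} (S : Over X) :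
    (Over.star S).IsLeftAdjoint := by
  let : CartesianMonoidalCategory (Over X) := .ofHasFiniteProducts
  obtain ⟨_⟩ := hasCartesianClosedSlices.{w} X
  exact _root_.star_isLeftAdjoint S

theorem of_equivalence {E : Type u₁} [Category.{v₁} E] (e : E ≌ T) :
    IsGrothendieckTopos.{w} E where
  exists_site := by
    obtain ⟨C, _, J, ⟨e'⟩⟩ := IsGrothendieckTopos.exists_site.{w} (E := T)
    exact ⟨C, inferInstance, J, ⟨e.trans e'⟩⟩

end IsGrothendieckTopos

namespace GeometricMorphism

section

variable {T : Type u} [Category.{v} T]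

theorem exists_section_of_isTerminal [HasFiniteLimits T] {S Y : T}
    [(Over.star Y).IsLeftAdjoint] (hS : IsTerminal S) (s : S ⟶ Y)
    [(Over.star (Over.mk s)).IsLeftAdjoint] :
    ∃ (x : GeometricMorphism T (Over Y)) (φ : x.comp (etale Y) ≅ ofEquivalence .refl)
      (t : x.inverse.obj (Over.mk (𝟙 Y)) ⟶ S), inducedSection φ.hom = t ≫ s := by
  let S' : Over Y := Over.mk s
  let ε : Over S' ≌ T := (Over.iteratedSliceEquiv S').trans (Over.equivalenceOfIsTerminal hS)
  let adj := (Over.forgetAdjStar S').comp (Over.forgetAdjStar Y)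
  have : (Over.forget S' ⋙ Over.forget Y).IsEquivalence := ε.isEquivalence_functor
  have := adj.isEquivalence_right_of_isEquivalence_left
  let counitIso : (Over.star Y ⋙ Over.star S') ⋙ Over.forget S' ⋙ Over.forget Y ≅ 𝟭 T :=
    asIso adj.counit
  let P : Over S' := (Over.star S').obj (Over.mk (𝟙 Y))
  refine ⟨(ofEquivalence ε.symm).comp (etale S'), isoMk counitIso, P.hom.left, ?_⟩
  have hcounit : adj.counit.app Y =
      (starCounit S' ((Over.star Y).obj Y)).left ≫ starCounit Y Y :=
    Adjunction.comp_counit_app _ _ _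
  calc
    _ = ((Over.star S').map (diagonalSection Y)).left.left ≫
        (starCounit S' ((Over.star Y).obj Y)).left ≫ starCounit Y Y := _ ≫= hcounit
    _ = (starCounit S' (Over.mk (𝟙 Y))).left ≫ (diagonalSection Y).left ≫ starCounit Y Y := by
      rw [← Over.comp_left_assoc, star_map_left_starCounit, Over.comp_left_assoc]
    _ = (starCounit S' (Over.mk (𝟙 Y))).left ≫ 𝟙 Y :=
      _ ≫= starUnit_left_starCounit (Over.mk (𝟙 Y))
    _ = P.left.hom := Over.w (starCounit S' (Over.mk (𝟙 Y)))
    _ = _ := (Over.w P.hom).symm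

theorem exists_lift_of_section [IsGrothendieckTopos.{w} T] {E : Type u₁} [Category.{v₁} E]
    [HasFiniteLimits E] {Y : E} [(Over.star Y).IsLeftAdjoint] (g : GeometricMorphism T E) {S : T}
    (hS : IsTerminal S) (s : S ⟶ g.inverse.obj Y) :
    ∃ (x : GeometricMorphism T (Over Y)) (φ : x.comp (etale Y) ≅ g)
      (t : x.inverse.obj (Over.mk (𝟙 Y)) ⟶ S), inducedSection φ.hom = t ≫ s := by
  have := IsGrothendieckTopos.hasFiniteLimits.{w} T
  have := IsGrothendieckTopos.star_isLeftAdjoint.{w} (g.inverse.obj Y)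
  have := IsGrothendieckTopos.star_over_isLeftAdjoint.{w} (Over.mk s)
  obtain ⟨x, φ, t, h⟩ := exists_section_of_isTerminal hS s
  let unit : (ofEquivalence .refl).comp g ≅ g := isoMk g.inverse.rightUnitor
  let φ' : (x.comp (g.slice Y)).comp (etale Y) ≅ g :=
    ((comparison (sliceEtaleIso g Y) T).obj x).iso ≪≫ (postcomp T g).mapIso φ ≪≫ unit
  refine ⟨x.comp (g.slice Y), φ', x.inverse.map (mkIdIsoPost g.inverse).inv ≫ t, ?_⟩
  have hφ' : inducedSection φ'.hom = inducedSection
      (((comparison (sliceEtaleIso g Y) T).obj x).iso.hom ≫ (postcomp T g).map φ.hom) ≫ 𝟙 _ :=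
    (congr_arg inducedSection (Category.assoc _ _ _).symm).trans (inducedSection_comp _ _)
  refine hφ'.trans ((Category.comp_id _).trans ((inducedSection_comparison φ.hom).trans ?_))
  exact (_ ≫= h).trans (Category.assoc _ _ _).symm

end

section

variable {E : Type u₁} [Category.{v₁} E] {F : Type u₂} [Category.{v₂} F]
  [HasFiniteLimits E] [HasFiniteLimits F]

theorem isTwoPullback_sliceEtaleIso (f : GeometricMorphism E F) (Y : F)
    [(Over.star Y).IsLeftAdjoint] [(Over.star (f.inverse.obj Y)).IsLeftAdjoint] :
    IsTwoPullback.{w, v, u} (sliceEtaleIso f Y) := fun _ _ _ =>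
  { essSurj := essSurj_comparison_sliceEtaleIso
      fun g _ hS s => exists_lift_of_section.{w} g hS s }

end

section

variable {P : Type u₁} [Category.{v₁} P] {A : Type u₂} [Category.{v₂} A]
  {B : Type u₃} [Category.{v₃} B] {D : Type u₄} [Category.{v₄} D]

theorem isEquivalence_postcomp_ofEquivalence (e : A ≌ B) (T : Type u) [Category.{v} T] :
    (postcomp T (ofEquivalence e)).IsEquivalence :=
  (CategoryTheory.Equivalence.mk (postcomp T (ofEquivalence e)) (postcomp T (ofEquivalence e.symm))
    (NatIso.ofComponents (fun x => isoMk (Functor.isoWhiskerRight e.unitIso x.inverse))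
      fun β => hom_ext (NatTrans.ext (funext fun X => ((app β).naturality (e.unit.app X)).symm)))
    (NatIso.ofComponents (fun x => isoMk (Functor.isoWhiskerRight e.counitIso x.inverse))
      fun β => hom_ext (NatTrans.ext (funext fun X =>
        ((app β).naturality (e.counit.app X)).symm)))).isEquivalence_functor

/-- The comparison functors of a square and of its composite with an equivalence are isomorphic. -/
def comparisonCompIso {Q : Type u} [Category.{v} Q]
    {p : GeometricMorphism P A} {q : GeometricMorphism P B}
    {f : GeometricMorphism A D} {g : GeometricMorphism B D} (α : p.comp f ≅ q.comp g)
    (e : GeometricMorphism Q P) {q' : GeometricMorphism Q B} (θ : q' ≅ e.comp q)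
    (T : Type*) [Category* T] :
    postcomp T e ⋙ comparison α T ≅
      comparison (assoc e p f ≪≫ (precomp e D).mapIso α ≪≫ (assoc e q g).symm ≪≫
      (postcomp Q g).mapIso θ.symm) T :=
  NatIso.ofComponents
    (fun x => CategoricalPullback.mkIso (assoc x e p)
      (assoc x e q ≪≫ (precomp x B).mapIso θ.symm) <|
        hom_ext <| NatTrans.ext <| funext fun d => by
        change 𝟙 _ ≫ 𝟙 _ ≫ x.inverse.map (𝟙 _ ≫ e.inverse.map ((app α.hom).app d) ≫ 𝟙 _ ≫
            (app θ.inv).app (g.inverse.obj d)) ≫ 𝟙 _ =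
          (𝟙 _ ≫ x.inverse.map (e.inverse.map ((app α.hom).app d)) ≫ 𝟙 _) ≫
            𝟙 _ ≫ x.inverse.map ((app θ.inv).app (g.inverse.obj d))
        simp only [Category.id_comp, Category.comp_id, Functor.map_comp]
        exact _ ≫= congr_arg x.inverse.map (Category.id_comp _))
    (fun {_ y} β => CategoricalPullback.Hom.ext
      (hom_ext <| NatTrans.ext <| funext fun _ =>
        (Category.comp_id _).trans (Category.id_comp _).symm)
      (hom_ext <| NatTrans.ext <| funext fun b => calc
        _ = (app β).app _ ≫ y.inverse.map ((app θ.inv).app b) := _ ≫= Category.id_comp _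
        _ = _ := ((app β).naturality _).symm
        _ = _ := (Category.id_comp _).symm =≫ _))

theorem IsTwoPullback.of_equivalence.{w', v', u'} {Q : Type u} [Category.{v} Q]
    {p : GeometricMorphism P A} {q : GeometricMorphism P B}
    {f : GeometricMorphism A D} {g : GeometricMorphism B D} {α : p.comp f ≅ q.comp g}
    (hα : IsTwoPullback.{w', v', u'} α) (e : Q ≌ P) {q' : GeometricMorphism Q B}
    (θ : q' ≅ (ofEquivalence e).comp q) :
    ∃ β : ((ofEquivalence e).comp p).comp f ≅ q'.comp g, IsTwoPullback.{w', v', u'} β := by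
  refine ⟨assoc (ofEquivalence e) p f ≪≫ (precomp (ofEquivalence e) D).mapIso α ≪≫
    (assoc (ofEquivalence e) q g).symm ≪≫ (postcomp Q g).mapIso θ.symm, fun T _ _ => ?_⟩
  have := hα T
  have := isEquivalence_postcomp_ofEquivalence e T
  exact Functor.isEquivalence_of_iso (comparisonCompIso α (ofEquivalence e) θ T)

end

end GeometricMorphism

/-! ### Finitely presented etale arrows -/

section

variable {ℬ : Type u} [Category.{v} ℬ] [HasPushouts ℬ]

theorem isPushout_codiagonal_desc {K K' B C D : ℬ} {l : K ⟶ K'} {a : K ⟶ B} {c : K' ⟶ C}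
    {n : B ⟶ C} (h : IsPushout l a c n) (m : C ⟶ D) :
    IsPushout (pushout.codiagonal l)
      (pushout.map l l n (n ≫ m) c (c ≫ m) a h.w (by rw [reassoc_of% h.w])) (c ≫ m)
      (pushout.desc m (𝟙 D) (Category.comp_id _).symm) := by
  have h_inr : IsPushout (pushout.inr l l) (c ≫ m)
      (pushout.map l l n (n ≫ m) c (c ≫ m) a h.w (by rw [reassoc_of% h.w]))
      (pushout.inr n (n ≫ m)) := by
    refine IsPushout.of_top ?_ (pushout.inr_desc _ _ _) (IsPushout.of_hasPushout l l)
    rw [pushout.inl_desc, reassoc_of% h.w]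
    exact h.paste_vert (IsPushout.of_hasPushout n (n ≫ m))
  refine IsPushout.of_left ?_ (pushout.hom_ext ?_ ?_) h_inr
  · rw [pushout.inr_codiagonal, pushout.inr_desc]
    exact IsPushout.of_horiz_isIso ⟨by simp only [Category.id_comp, Category.comp_id]⟩
  · simp only [pushout.inl_codiagonal_assoc, pushout.inl_desc_assoc, Category.assoc,
      pushout.inl_desc]
  · simp only [pushout.inr_codiagonal_assoc, pushout.inr_desc_assoc, Category.assoc,
      pushout.inr_desc, Category.comp_id]

/-- The factorization of `m` through the cobase change of `n ≫ m` along `n`; the second factor is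
a cobase change of a codiagonal. -/
theorem pushouts_of_comp {P : MorphismProperty ℬ} [P.pushouts.IsStableUnderComposition]
    (hP : ∀ ⦃K K' : ℬ⦄ (l : K ⟶ K'), P l → P (pushout.codiagonal l)) {B C D : ℬ} {n : B ⟶ C}
    {m : C ⟶ D} (hn : P.pushouts n) (hnm : P.pushouts (n ≫ m)) : P.pushouts m := by
  obtain ⟨K, K', l, a, c, hl, h⟩ := hn
  have h_inl : P.pushouts (pushout.inl n (n ≫ m)) :=
    MorphismProperty.of_isPushout (IsPushout.of_hasPushout n (n ≫ m)) hnm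
  have h_desc : P.pushouts (pushout.desc m (𝟙 D) (Category.comp_id (n ≫ m)).symm) :=
    P.pushouts_mk (isPushout_codiagonal_desc h.flip m).flip (hP l hl)
  rw [← pushout.inl_desc m (𝟙 D) (Category.comp_id (n ≫ m)).symm]
  exact P.pushouts.comp_mem _ _ h_inl h_desc

end

section

variable {ℬ : Type u} [Category.{w} ℬ]
  {J : Type w} [SmallCategory J] [IsFiltered J] {D : J ⥤ ℬ} {c : Cocone D}

/-- The pushout of `l` along `D j ⟶ c.pt` is the filtered colimit of the pushouts of `l` along the
maps `D j ⟶ D k`. -/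
theorem exists_lift_pushout_of_isColimit [HasPushouts ℬ] (hc : IsColimit c) {j : J} {K' C L : ℬ}
    {l : D.obj j ⟶ K'} {c' : K' ⟶ C} {n : c.pt ⟶ C} (h : IsPushout l (c.ι.app j) c' n)
    [IsFinitelyPresentable.{w} L] (b : L ⟶ C) :
    ∃ (k : J) (u : j ⟶ k) (b₀ : L ⟶ pushout (D.map u) l) (d : pushout (D.map u) l ⟶ C),
      IsPushout (pushout.inl (D.map u) l) (c.ι.app k) d n ∧ b₀ ≫ d = b := by
  have : PreservesColimitsOfSize.{w, w} (Under.pushout l) :=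
    (Under.mapPushoutAdj l).leftAdjoint_preservesColimits
  let F : Under (D.obj j) ⥤ ℬ := Under.pushout l ⋙ Under.forget K'
  let e : F.obj (Under.mk (c.ι.app j)) ≅ C := h.flip.isoPushout.symm
  let s : Cocone (Under.post D ⋙ F) := (F.mapCocone (c.underPost j)).extend e.hom
  have he : IsIso e.hom := inferInstance
  have hs : IsColimit s := @IsColimit.extendIso _ _ _ _ _ (F.mapCocone (c.underPost j)) _ e.hom he
    (isColimitOfPreserves F (hc.underPost j))
  obtain ⟨k, b₀, hb₀⟩ := IsFinitelyPresentable.exists_hom_of_isColimit hs b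
  refine ⟨k.right, k.hom, b₀, s.ι.app k, ?_, hb₀⟩
  have h_inl : pushout.inl (D.map k.hom) l ≫ s.ι.app k = c.ι.app k.right ≫ n :=
    (pushout.inl_desc_assoc _ _ _ _).trans
      ((Category.assoc _ _ _).trans (_ ≫= h.flip.inl_isoPushout_inv))
  have h_inr : pushout.inr (D.map k.hom) l ≫ s.ι.app k = c' :=
    (pushout.inr_desc_assoc _ _ _ _).trans h.flip.inr_isoPushout_inv
  have hk : D.map k.hom ≫ c.ι.app k.right = c.ι.app j := c.w k.hom
  exact IsPushout.of_top (by rwa [h_inr, hk]) h_inl (IsPushout.of_hasPushout _ _).flip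

theorem exists_isColimit_isFinitelyPresentable [IsLocallyFinitelyPresentable.{w} ℬ]
    (B : ℬ) : ∃ (J : Type w) (_ : SmallCategory J) (_ : IsFiltered J) (D : J ⥤ ℬ)
      (ι : D ⟶ (Functor.const J).obj B), (∀ j, IsFinitelyPresentable.{w} (D.obj j)) ∧
        Nonempty (IsColimit (Cocone.mk B ι)) := by
  have : Fact (Cardinal.aleph0.{w}).IsRegular := ⟨Cardinal.isRegular_aleph0⟩
  obtain ⟨J, _, hJ, ⟨p⟩⟩ :=
    (isCardinalFilteredGenerator_isCardinalPresentable ℬ Cardinal.aleph0.{w}).exists_colimitsOfShape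
      B
  exact ⟨J, inferInstance, isFiltered_of_isCardinalFiltered J Cardinal.aleph0.{w}, p.diag, p.ι,
    p.prop_diag_obj, ⟨p.isColimit⟩⟩

end

namespace SaturatedClass

variable {ℬ : Type u} [Category.{w} ℬ] [HasPushouts ℬ] (𝒱 : SaturatedClass ℬ)

theorem maps_codiagonal ⦃K K' : ℬ⦄ (l : K ⟶ K') (hl : 𝒱.maps l) :
    𝒱.maps (pushout.codiagonal l) := by
  have hK' := 𝒱.target_mem l hl
  refine 𝒱.cancel (pushout.inl l l) _
    (𝒱.pushout_mem (IsPushout.of_hasPushout l l).flip hK' hl) ?_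
  rw [pushout.inl_codiagonal]
  exact 𝒱.iso_mem _ hK' hK' inferInstance

theorem exists_isPushout_of_isColimit {J : Type w} [SmallCategory J] [IsFiltered J] {D : J ⥤ ℬ}
    {c : Cocone D} (hc : IsColimit c) (hD : ∀ j, IsFinitelyPresentable.{w} (D.obj j)) {C : ℬ}
    {n : c.pt ⟶ C} (hn : 𝒱.maps.pushouts n) :
    ∃ (j : J) (K' : ℬ) (l : D.obj j ⟶ K') (c' : K' ⟶ C),
      𝒱.maps l ∧ IsPushout l (c.ι.app j) c' n := by
  obtain ⟨K, K', l, a, c', hl, h⟩ := hn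
  have := 𝒱.source_mem l hl
  obtain ⟨j, a', rfl⟩ := IsFinitelyPresentable.exists_hom_of_isColimit hc a
  have ha' := IsPushout.of_hasPushout l a'
  exact ⟨j, _, _, _, 𝒱.pushout_mem ha' (hD j) hl, IsPushout.of_top' h.flip ha'⟩

instance isStableUnderComposition_pushouts [IsLocallyFinitelyPresentable.{w} ℬ] :
    𝒱.maps.pushouts.IsStableUnderComposition where
  comp_mem {B C C'} n m hn hm := by
    obtain ⟨J, _, _, D, ι, hD, ⟨hc⟩⟩ := exists_isColimit_isFinitelyPresentable B
    obtain ⟨j, K', l, c', hl, h⟩ := 𝒱.exists_isPushout_of_isColimit hc hD hn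
    obtain ⟨L, L', l', b, b', hl', h'⟩ := hm
    have := 𝒱.source_mem l' hl'
    obtain ⟨k, u, b₀, d, hd, rfl⟩ := exists_lift_pushout_of_isColimit hc h b
    have hinl : 𝒱.maps (pushout.inl (D.map u) l) :=
      𝒱.pushout_mem (IsPushout.of_hasPushout _ _).flip (hD k) hl
    have hb₀ := IsPushout.of_hasPushout l' b₀
    have hinr : 𝒱.maps (pushout.inr l' b₀) := 𝒱.pushout_mem hb₀ (𝒱.target_mem _ hinl) hl'
    exact 𝒱.maps.pushouts_mk (hd.paste_horiz (IsPushout.of_top' h'.flip hb₀)).flip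
      (𝒱.comp_mem _ _ hinl hinr)

end SaturatedClass

namespace Geometry

variable {ℬ : Type u} [Category.{w} ℬ] (𝒢 : Geometry ℬ)

theorem isFPEtale_iff {B : ℬ} (n : Under B) : 𝒢.IsFPEtale B n ↔ 𝒢.𝒱.maps.pushouts n.hom :=
  ⟨fun ⟨_, _, _, _, _, hl, h⟩ => ⟨_, _, _, _, _, hl, h.flip⟩,
    fun ⟨_, _, _, _, _, hl, h⟩ => ⟨_, _, _, _, _, hl, h.flip⟩⟩

end Geometry

/-! ### Slices over representable presheaves and sheaves -/

theorem functorPullback_mem_iff {T : Type u₁} [Category.{v₁} T] {S : Type u₂} [Category.{v₂} S]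
    {J : GrothendieckTopology T} {K : GrothendieckTopology S} {G : S ⥤ T} [G.IsCocontinuous K J]
    (hG : CoverPreserving K J G) {d : S} (R : Sieve (G.obj d)) :
    R.functorPullback G ∈ K d ↔ R ∈ J (G.obj d) :=
  ⟨fun h => J.superset_covering (Sieve.functorPullback_pushforward_le G R) (hG.cover_preserve h),
    G.cover_lift K J⟩

section

variable {T : Type u₁} [Category.{w} T] {S : Type u₂} [Category.{w} S] {X : T} (V : S ⥤ Over X)

/-- The functor to the category of elements of `yoneda.obj X` given by a functor to `Over X`. -/
def toCostructuredArrowYoneda : S ⥤ CostructuredArrow yoneda (yoneda.obj X) :=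
  V ⋙ CostructuredArrow.post (𝟭 T) yoneda X

/-- A presheaf `P` over `yoneda.obj X` is a presheaf on `Over X`; this is its restriction along
`V : S ⥤ Over X`. Its sections at `d` are the elements of `P` at `(V.obj d).left` lying over
`(V.obj d).hom`. -/
def overYonedaRestrict : Over (yoneda.obj X) ⥤ Sᵒᵖ ⥤ Type w :=
  (overEquivPresheafCostructuredArrow (yoneda.obj X)).functor ⋙
    (Functor.whiskeringLeft _ _ (Type w)).obj (toCostructuredArrowYoneda V).op

instance [V.IsEquivalence] : (toCostructuredArrowYoneda V).IsEquivalence :=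
  let W : Over X ⥤ CostructuredArrow yoneda (yoneda.obj X) := CostructuredArrow.post (𝟭 T) yoneda X
  have : W.IsEquivalence := CostructuredArrow.isEquivalence_post _ _ _
  inferInstanceAs (V ⋙ W).IsEquivalence

instance [V.IsEquivalence] : (overYonedaRestrict V).IsEquivalence :=
  inferInstanceAs ((overEquivPresheafCostructuredArrow (yoneda.obj X)).functor ⋙
    (Functor.whiskeringLeft _ _ (Type w)).obj (toCostructuredArrowYoneda V).op).IsEquivalence

namespace overYonedaRestrict

variable {V}

/-- The element of `P` underlying a section of `(overYonedaRestrict V).obj P`. -/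
def val {P : Over (yoneda.obj X)} {d : S} (x : ((overYonedaRestrict V).obj P).obj (op d)) :
    P.left.obj (op (V.obj d).left) :=
  OverPresheafAux.OverArrows.val x

theorem val_injective {P : Over (yoneda.obj X)} {d : S} :
    Function.Injective (val : ((overYonedaRestrict V).obj P).obj (op d) → _) :=
  fun _ _ => OverPresheafAux.OverArrows.ext

theorem hom_app_val {P : Over (yoneda.obj X)} {d : S}
    (x : ((overYonedaRestrict V).obj P).obj (op d)) :
    P.hom.app _ (val x) = (V.obj d).hom :=
  (OverPresheafAux.OverArrows.app_val x).trans (yonedaEquiv_yoneda_map _)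

theorem exists_val_eq {P : Over (yoneda.obj X)} {d : S} (x : P.left.obj (op (V.obj d).left))
    (h : P.hom.app _ x = (V.obj d).hom) :
    ∃ y : ((overYonedaRestrict V).obj P).obj (op d), val y = x :=
  ⟨⟨x, ⟨h.trans (yonedaEquiv_yoneda_map _).symm⟩⟩, rfl⟩

variable (V) in
theorem exists_map_val_eq [V.EssSurj] {P : Over (yoneda.obj X)} {U : T} (s : U ⟶ X) :
    ∃ (d : S) (i : U ≅ (V.obj d).left), ∀ x : P.left.obj (op U), P.hom.app _ x = s →
      ∃ x' : ((overYonedaRestrict V).obj P).obj (op d), P.left.map i.hom.op (val x') = x := by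
  let e : V.obj (V.objPreimage (Over.mk s)) ≅ Over.mk s := V.objObjPreimageIso (Over.mk s)
  let i : U ≅ (V.obj (V.objPreimage (Over.mk s))).left := (Over.forget X).mapIso e.symm
  refine ⟨_, i, fun x hx => ?_⟩
  have hx' : P.hom.app _ (P.left.map i.inv.op x) = (V.obj (V.objPreimage (Over.mk s))).hom := by
    rw [NatTrans.naturality_apply, hx]
    exact Over.w e.hom
  obtain ⟨x', hx'⟩ := exists_val_eq (V := V) _ hx'
  refine ⟨x', ?_⟩
  rw [hx', ← ConcreteCategory.comp_apply, ← P.left.map_comp, ← op_comp, i.hom_inv_id, op_id,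
    P.left.map_id, ConcreteCategory.id_apply]

theorem functorPullback_equalizerSieve_val {P : Over (yoneda.obj X)} {d : S}
    (x y : ((overYonedaRestrict V).obj P).obj (op d)) :
    (Presheaf.equalizerSieve (F := P.left) (X := op (V.obj d).left) (val x) (val y)).functorPullback
        (V ⋙ Over.forget X) =
      Presheaf.equalizerSieve (F := (overYonedaRestrict V).obj P) (X := op d) x y :=
  Sieve.ext fun _ f =>
    val_injective.eq_iff (a := ((overYonedaRestrict V).obj P).map f.op x)
      (b := ((overYonedaRestrict V).obj P).map f.op y)

theorem functorPullback_imageSieve_val {P Q : Over (yoneda.obj X)} (φ : P ⟶ Q) {d : S}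
    (x : ((overYonedaRestrict V).obj Q).obj (op d)) :
    (Presheaf.imageSieve φ.left (val x)).functorPullback (V ⋙ Over.forget X) =
      Presheaf.imageSieve ((overYonedaRestrict V).map φ) x := by
  ext d' f
  constructor
  · rintro ⟨y, hy⟩
    change P.left.obj (op (V.obj d').left) at y
    change φ.left.app _ y = Q.left.map (V.map f).left.op (val x) at hy
    have hy' : P.hom.app _ y = (V.obj d').hom := by
      rw [← Over.w φ, NatTrans.comp_app, ConcreteCategory.comp_apply, hy,
        NatTrans.naturality_apply, hom_app_val]
      exact Over.w (V.map f)
    obtain ⟨z, rfl⟩ := exists_val_eq y hy'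
    exact ⟨z, val_injective hy⟩
  · rintro ⟨z, hz⟩
    exact ⟨val z, congr_arg val hz⟩

end overYonedaRestrict

section

open Presheaf overYonedaRestrict

variable {V} {J : GrothendieckTopology T} {K : GrothendieckTopology S}
  [(V ⋙ Over.forget X).IsCocontinuous K J] (hV : CoverPreserving K J (V ⋙ Over.forget X))

include hV

theorem equalizerSieve_val_mem_iff {P : Over (yoneda.obj X)} {d : S}
    (x y : ((overYonedaRestrict V).obj P).obj (op d)) :
    equalizerSieve (F := P.left) (X := op (V.obj d).left) (val x) (val y) ∈ J (V.obj d).left ↔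
      equalizerSieve (F := (overYonedaRestrict V).obj P) (X := op d) x y ∈ K d := by
  rw [← functorPullback_equalizerSieve_val]
  exact (functorPullback_mem_iff hV _).symm

theorem imageSieve_val_mem_iff {P Q : Over (yoneda.obj X)} (φ : P ⟶ Q) {d : S}
    (x : ((overYonedaRestrict V).obj Q).obj (op d)) :
    imageSieve φ.left (val x) ∈ J (V.obj d).left ↔
      imageSieve ((overYonedaRestrict V).map φ) x ∈ K d := by
  rw [← functorPullback_imageSieve_val]
  exact (functorPullback_mem_iff hV _).symm

variable [V.EssSurj]

theorem isLocallyInjective_overYonedaRestrict_map_iff {P Q : Over (yoneda.obj X)} (φ : P ⟶ Q) :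
    IsLocallyInjective K ((overYonedaRestrict V).map φ) ↔ IsLocallyInjective J φ.left := by
  refine ⟨fun h => ⟨fun {U} x y hxy => ?_⟩, fun h => ⟨fun {d} x y hxy => ?_⟩⟩
  · have hxy_hom : P.hom.app _ x = P.hom.app _ y := by
      rw [← Over.w φ, NatTrans.comp_app, ConcreteCategory.comp_apply, ConcreteCategory.comp_apply,
        hxy]
    obtain ⟨d, i, hi⟩ := exists_map_val_eq V (P := P) (U := U.unop) (P.hom.app _ y)
    obtain ⟨x', rfl⟩ := hi x hxy_hom
    obtain ⟨y', rfl⟩ := hi y rfl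
    have h_inj : Function.Injective (Q.left.map i.hom.op) := injective_of_mono _
    have hxy' : ((overYonedaRestrict V).map φ).app (op d) x' =
        ((overYonedaRestrict V).map φ).app (op d) y' :=
      val_injective (h_inj (by rwa [NatTrans.naturality_apply, NatTrans.naturality_apply] at hxy))
    refine J.superset_covering (fun Z f hf => ?_) (J.pullback_stable i.hom
      ((equalizerSieve_val_mem_iff hV x' y').2
        (equalizerSieve_mem K ((overYonedaRestrict V).map φ) x' y' hxy')))
    simpa using hf
  · exact (equalizerSieve_val_mem_iff hV x y).1
      (equalizerSieve_mem J φ.left (val x) (val y) (congr_arg val hxy))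

theorem isLocallySurjective_overYonedaRestrict_map_iff {P Q : Over (yoneda.obj X)} (φ : P ⟶ Q) :
    IsLocallySurjective K ((overYonedaRestrict V).map φ) ↔ IsLocallySurjective J φ.left := by
  refine ⟨fun h => ⟨fun {U} x => ?_⟩, fun h => ⟨fun {d} x => ?_⟩⟩
  · obtain ⟨d, i, hi⟩ := exists_map_val_eq V (P := Q) (Q.hom.app _ x)
    obtain ⟨x', rfl⟩ := hi x rfl
    refine J.superset_covering ?_ (J.pullback_stable i.hom
      ((imageSieve_val_mem_iff hV φ x').2 (imageSieve_mem K ((overYonedaRestrict V).map φ) x')))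
    rintro Z f ⟨y, hy⟩
    exact ⟨y, by simpa using hy⟩
  · exact (imageSieve_val_mem_iff hV φ x).1 (imageSieve_mem J φ.left (val x))

end

end

section

variable {T : Type u₁} [Category.{w} T] [EssentiallySmall.{w} T] {S : Type u₂} [Category.{w} S]
  [EssentiallySmall.{w} S] {X : T} (V : S ⥤ Over X) [V.IsEquivalence]
  {J : GrothendieckTopology T} {K : GrothendieckTopology S}
  [(V ⋙ Over.forget X).IsCocontinuous K J] (hV : CoverPreserving K J (V ⋙ Over.forget X))
  [HasSheafify J (Type w)] [HasSheafify K (Type w)]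

/-- Restriction of presheaves over `yoneda.obj X` to `S`, followed by sheafification. -/
def overYonedaToSheaf : Over (yoneda.obj X) ⥤ Sheaf K (Type w) :=
  overYonedaRestrict V ⋙ presheafToSheaf K (Type w)

include hV in
theorem isIso_overYonedaToSheaf_map_iff {P Q : Over (yoneda.obj X)} (φ : P ⟶ Q) :
    IsIso ((overYonedaToSheaf V (K := K)).map φ) ↔
      IsIso ((Over.post (presheafToSheaf J (Type w))).map φ) := by
  have : J.WEqualsLocallyBijective (Type w) := .ofEssentiallySmall.{w} J
  have : K.WEqualsLocallyBijective (Type w) := .ofEssentiallySmall.{w} K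
  rw [← isIso_iff_of_reflects_iso _ (Over.forget _)]
  change IsIso ((presheafToSheaf K (Type w)).map ((overYonedaRestrict V).map φ)) ↔
    IsIso ((presheafToSheaf J (Type w)).map φ.left)
  rw [← K.W_iff, ← J.W_iff, J.W_iff_isLocallyBijective, K.W_iff_isLocallyBijective,
    isLocallyInjective_overYonedaRestrict_map_iff hV,
    isLocallySurjective_overYonedaRestrict_map_iff hV]

instance isLocalization_overYonedaToSheaf : (overYonedaToSheaf V (K := K)).IsLocalization
    ((MorphismProperty.isomorphisms _).inverseImage (overYonedaToSheaf V (K := K))) :=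
  ((overYonedaRestrict V).asEquivalence.toAdjunction.comp
    (sheafificationAdjunction K (Type w))).isLocalization

include hV in
theorem isLocalization_overPost_presheafToSheaf :
    (Over.post (X := yoneda.obj X) (presheafToSheaf J (Type w))).IsLocalization
      ((MorphismProperty.isomorphisms _).inverseImage (overYonedaToSheaf V (K := K))) := by
  have h : (MorphismProperty.isomorphisms _).inverseImage (overYonedaToSheaf V (K := K)) =
      (MorphismProperty.isomorphisms _).inverseImage
        (Over.post (X := yoneda.obj X) (presheafToSheaf J (Type w))) :=
    MorphismProperty.ext _ _ fun _ _ φ => isIso_overYonedaToSheaf_map_iff V hV φ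
  rw [h]
  exact isLocalization_overPost (sheafificationAdjunction J (Type w)) _

/-- For `S` equivalent to `Over X`, sheaves over the sheaf represented by `X` are sheaves on `S`:
both categories are localizations of `Over (yoneda.obj X)` at the same maps. -/
def overSheafEquivalence :
    Over ((presheafToSheaf J (Type w)).obj (yoneda.obj X)) ≌ Sheaf K (Type w) :=
  have := isLocalization_overPost_presheafToSheaf V hV
  Localization.uniq (Over.post (X := yoneda.obj X) (presheafToSheaf J (Type w)))
    (overYonedaToSheaf V (K := K))
    ((MorphismProperty.isomorphisms _).inverseImage (overYonedaToSheaf V (K := K)))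

/-- `overSheafEquivalence` commutes with sheafification. -/
def postCompOverSheafEquivalence :
    Over.post (X := yoneda.obj X) (presheafToSheaf J (Type w)) ⋙
      (overSheafEquivalence V hV).functor ≅ overYonedaToSheaf V (K := K) :=
  have := isLocalization_overPost_presheafToSheaf V hV
  Localization.compUniqFunctor (Over.post (X := yoneda.obj X) (presheafToSheaf J (Type w)))
    (overYonedaToSheaf V (K := K))
    ((MorphismProperty.isomorphisms _).inverseImage (overYonedaToSheaf V (K := K)))

end

section

variable {T : Type u₁} [Category.{w} T] {S : Type u₂} [Category.{w} S] {X : T} (V : S ⥤ Over X)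

open overYonedaRestrict

/-- The Yoneda lemma for the sections of `(overYonedaRestrict V).obj P`. -/
def overYonedaRestrict.homEquiv (P : Over (yoneda.obj X)) (d : S) :
    (Over.mk (yoneda.map (V.obj d).hom) ⟶ P) ≃ ((overYonedaRestrict V).obj P).obj (op d) where
  toFun s := ⟨yonedaEquiv s.left,
    ⟨(yonedaEquiv_comp s.left P.hom).symm.trans (congr_arg yonedaEquiv (Over.w s))⟩⟩
  invFun x := Over.homMk (yonedaEquiv.symm (val x)) (yonedaEquiv.injective (by
    rw [yonedaEquiv_comp, Equiv.apply_symm_apply]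
    exact (hom_app_val x).trans (yonedaEquiv_yoneda_map _).symm))
  left_inv s := Over.OverMorphism.ext (yonedaEquiv.symm_apply_apply s.left)
  right_inv x := val_injective (yonedaEquiv.apply_symm_apply (val x))

/-- The restriction to `S` of the product of a presheaf `P` with `yoneda.obj X` is the restriction
of `P`. -/
def starCompOverYonedaRestrict : Over.star (yoneda.obj X) ⋙ overYonedaRestrict V ⟶
    (Functor.whiskeringLeft _ _ (Type w)).obj (V ⋙ Over.forget X).op where
  app P :=
    { app d := ↾fun x => (starCounit (yoneda.obj X) P).app _ (val (d := d.unop) x)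
      naturality d d' f := by
        ext x
        exact NatTrans.naturality_apply (starCounit (yoneda.obj X) P) (V.map f.unop).left.op
          (val (d := d.unop) x) }
  naturality P Q φ := by
    ext d x
    exact ConcreteCategory.congr_hom
      (NatTrans.congr_app (star_map_left_starCounit φ) (op (V.obj d.unop).left))
      (val (d := d.unop) x)

theorem starCompOverYonedaRestrict_app_homEquiv (P : Tᵒᵖ ⥤ Type w) (d : S)
    (s : Over.mk (yoneda.map (V.obj d).hom) ⟶ (Over.star (yoneda.obj X)).obj P) :
    ((starCompOverYonedaRestrict V).app P).app (op d) (homEquiv V _ d s) =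
      yonedaEquiv (((Over.forgetAdjStar (yoneda.obj X)).homEquiv _ P).symm s) :=
  (yonedaEquiv_comp s.left (starCounit (yoneda.obj X) P)).symm

instance : IsIso (starCompOverYonedaRestrict V) := by
  rw [NatTrans.isIso_iff_isIso_app]
  intro P
  rw [NatTrans.isIso_iff_isIso_app]
  rintro ⟨d⟩
  rw [isIso_iff_bijective]
  refine (Function.Bijective.of_comp_iff _ (homEquiv V _ d).bijective).1 ?_
  rw [funext (f := _ ∘ _) (starCompOverYonedaRestrict_app_homEquiv V P d)]
  exact yonedaEquiv.bijective.comp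
    ((Over.forgetAdjStar (yoneda.obj X)).homEquiv (Over.mk _) P).symm.bijective

/-- The restriction to `S` of the product of a representable presheaf with `yoneda.obj X` is
representable, when the functor `S ⥤ T` has a right adjoint. -/
def yonedaCompStarIso {p : T ⥤ S} (adj : V ⋙ Over.forget X ⊣ p) :
    yoneda ⋙ Over.star (yoneda.obj X) ⋙ overYonedaRestrict V ≅ p ⋙ yoneda :=
  Functor.isoWhiskerLeft yoneda (asIso (starCompOverYonedaRestrict V)) ≪≫ adj.compYonedaIso.symm

end

/-! ### Left Kan extensions along a reflected Yoneda embedding -/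

/-- `L` is a localization, so that `F` is the left Kan extension of `L ⋙ F` along `L`; and `L ⋙ F`,
being a left adjoint on presheaves, is a left Kan extension along the Yoneda embedding. -/
theorem isLeftKanExtension_yoneda_comp {C : Type u₁} [Category.{w} C] {E : Type u₂}
    [Category.{v₂} E] {L : (Cᵒᵖ ⥤ Type w) ⥤ E} {R : E ⥤ Cᵒᵖ ⥤ Type w} (adj : L ⊣ R) [R.Full]
    [R.Faithful] {H : Type u₃} [Category.{v₃} H] (F : E ⥤ H) [F.IsLeftAdjoint] :
    F.IsLeftKanExtension (𝟙 ((yoneda ⋙ L) ⋙ F)) := by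
  have := adj.isLeftAdjoint
  have := adj.isLocalization
  have h_yoneda : (L ⋙ F).IsLeftKanExtension (𝟙 (yoneda (C := C) ⋙ L ⋙ F)) := by
    have : PreservesColimitsOfSize.{w, max w u₁} (L ⋙ F) :=
      (Adjunction.ofIsLeftAdjoint (L ⋙ F)).leftAdjoint_preservesColimits
    have h : (𝟭 _ ⋙ L ⋙ F).IsLeftKanExtension
        (Functor.whiskerRight (Functor.rightUnitor (yoneda (C := C))).inv (L ⋙ F) ≫
          (Functor.associator _ _ _).hom) :=
      Functor.PreservesLeftKanExtension.preserves _ _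
    refine (Functor.isLeftKanExtension_iff_of_iso (Functor.leftUnitor _) _ _ ?_).1 h
    ext X : 2
    simp
  have h_localization : F.IsLeftKanExtension (𝟙 (L ⋙ F)) :=
    (Functor.isRightDerivedFunctor_iff_isLeftKanExtension F (𝟙 (L ⋙ F))
      ((MorphismProperty.isomorphisms _).inverseImage L)).1
        (Functor.isRightDerivedFunctor_of_inverts _ F (Iso.refl (L ⋙ F)))
  exact (Functor.isLeftKanExtension_iff_postcompose (𝟙 (yoneda (C := C) ⋙ L ⋙ F)) (yoneda ⋙ L)
    (Iso.refl _) (𝟙 (L ⋙ F)) _ (by ext; simp)).1 h_localization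

/-! ### The spectral site of an etale map -/

theorem isCocontinuous_toGrothendieck {T : Type u₁} [Category.{v₁} T] {S : Type u₂}
    [Category.{v₂} S] {P : Precoverage T} {K : GrothendieckTopology S} {G : S ⥤ T}
    (hP : ∀ {Y : T} {R : Presieve Y}, R ∈ P Y → ∀ {d : S} (φ : G.obj d ⟶ Y),
      ((Sieve.generate R).pullback φ).functorPullback G ∈ K d) :
    G.IsCocontinuous K P.toGrothendieck := by
  have h {Y : T} {R : Sieve Y} (hR : R ∈ P.toGrothendieck Y) {d : S} (φ : G.obj d ⟶ Y) :
      (R.pullback φ).functorPullback G ∈ K d := by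
    induction hR generalizing d with
    | of _ _ hR => exact hP hR φ
    | top _ => exact K.superset_covering (fun _ _ _ => trivial) (K.top_mem d)
    | pullback _ _ _ _ _ ih =>
      rw [← Sieve.pullback_comp]
      exact ih _
    | transitive _ _ R _ _ ih ih' =>
      refine K.transitive (ih φ) _ fun d' f hf => K.superset_covering (fun d'' g hg => ?_)
        (ih' hf (𝟙 (G.obj d')))
      have hg : R ((G.map g ≫ 𝟙 _) ≫ G.map f ≫ φ) := hg
      change R (G.map (g ≫ f) ≫ φ)
      rwa [Category.comp_id, ← Category.assoc, ← G.map_comp] at hg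
  refine ⟨fun {d R} hR => ?_⟩
  rw [← Sieve.pullback_id (S := R)]
  exact h hR (𝟙 _)

namespace Geometry

variable {ℬ : Type u} [Category.{w} ℬ] [IsLocallyFinitelyPresentable.{w} ℬ] (𝒢 : Geometry ℬ)
  {B C : ℬ} (n : B ⟶ C) (hn : 𝒢.IsFPEtale B (Under.mk n))

/-- Composition with a finitely presented etale arrow, as a functor `𝒱_C ⥤ 𝒱_B`. -/
def precompose : 𝒢.EtaleGenerator C ⥤ 𝒢.EtaleGenerator B :=
  ObjectProperty.lift _ ((𝒢.IsFPEtale C).ι ⋙ Under.map n) fun d =>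
    (𝒢.isFPEtale_iff _).2 (𝒢.𝒱.maps.pushouts.comp_mem n d.obj.hom ((𝒢.isFPEtale_iff _).1 hn)
      ((𝒢.isFPEtale_iff _).1 d.property))

/-- Pushout along an etale map is left adjoint to composition with it. -/
def pushAdjPrecompose : 𝒢.push n ⊣ 𝒢.precompose n hn :=
  (Under.mapPushoutAdj n).restrictFullyFaithful (𝒢.IsFPEtale B).fullyFaithfulι
    (𝒢.IsFPEtale C).fullyFaithfulι (Iso.refl _) (Iso.refl _)

/-- The functor from the spectral site of `C` to the slice over `n` of the spectral site of `B`
which composes etale arrows with `n`. -/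
def siteOver : 𝒢.Site C ⥤ Over (op ⟨Under.mk n, hn⟩ : 𝒢.Site B) where
  obj d := Over.mk (Y := op ((𝒢.precompose n hn).obj d.unop))
    (ObjectProperty.homMk (Under.homMk d.unop.obj.hom rfl) :
      (⟨Under.mk n, hn⟩ : 𝒢.EtaleGenerator B) ⟶ (𝒢.precompose n hn).obj d.unop).op
  map f := Over.homMk ((𝒢.precompose n hn).map f.unop).op (by
    apply Quiver.Hom.unop_inj
    ext
    exact Under.w f.unop.hom)
  map_id _ := by ext; rfl
  map_comp _ _ := by ext; rfl

instance : (𝒢.siteOver n hn).Faithful where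
  map_injective h := by
    apply Quiver.Hom.unop_inj
    ext
    exact congr_arg (fun f => f.left.unop.hom.right) h

instance : (𝒢.siteOver n hn).Full where
  map_surjective {d d'} f := by
    have hf : d'.unop.obj.hom ≫ f.left.unop.hom.right = d.unop.obj.hom :=
      congr_arg (fun f => f.unop.hom.right) (Over.w f)
    refine ⟨(ObjectProperty.homMk (Under.homMk f.left.unop.hom.right hf) : d'.unop ⟶ d.unop).op, ?_⟩
    ext
    rfl

variable {𝒢} in
theorem pushouts_hom_right {Y Z : 𝒢.EtaleGenerator B} (m : Y ⟶ Z) :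
    𝒢.𝒱.maps.pushouts m.hom.right := by
  have hZ := (𝒢.isFPEtale_iff _).1 Z.property
  rw [← Under.w m.hom] at hZ
  exact pushouts_of_comp 𝒢.𝒱.maps_codiagonal ((𝒢.isFPEtale_iff _).1 Y.property) hZ

instance : (𝒢.siteOver n hn).EssSurj where
  mem_essImage Y := by
    have hm : n ≫ Y.hom.unop.hom.right = Y.left.unop.obj.hom := Under.w Y.hom.unop.hom
    let d : 𝒢.EtaleGenerator C :=
      ⟨Under.mk Y.hom.unop.hom.right, (𝒢.isFPEtale_iff _).2 (pushouts_hom_right Y.hom.unop)⟩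
    let i : Y.left.unop ≅ (𝒢.precompose n hn).obj d :=
      (𝒢.IsFPEtale B).isoMk (Under.isoMk (Iso.refl _) ((Category.comp_id _).trans hm.symm))
    refine ⟨op d, ⟨Over.isoMk i.op ?_⟩⟩
    apply Quiver.Hom.unop_inj
    ext
    exact Category.comp_id _

instance : (𝒢.siteOver n hn).IsEquivalence where

theorem map_siteOver_mem_coverings {d : 𝒢.Site C} {R : Presieve d} (hR : R ∈ 𝒢.coverings C d) :
    R.map (𝒢.siteOver n hn ⋙ Over.forget _) ∈ 𝒢.coverings B _ := by
  obtain ⟨I, n', m, K, K', l, b, b', hl, h, rfl⟩ := hR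
  refine ⟨I, fun i => (𝒢.precompose n hn).obj (n' i), fun i => (𝒢.precompose n hn).map (m i),
    K, K', l, b, b', hl, h, ?_⟩
  rw [Presieve.map_ofArrows]
  rfl

theorem coverPreserving_siteOver : CoverPreserving (𝒢.topology C) (𝒢.topology B)
    (𝒢.siteOver n hn ⋙ Over.forget _) := by
  let J := (𝒢.topology B).over (op ⟨Under.mk n, hn⟩)
  have h_le : 𝒢.topology C ≤ (𝒢.siteOver n hn).restrictedTopology J := by
    refine Precoverage.toGrothendieck_le_iff_le_toPrecoverage.2 fun d R hR => ?_
    refine Functor.mem_restrictedTopology_of_functorPushforward_mem ?_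
    have hR' := Precoverage.generate_mem_toGrothendieck (𝒢.map_siteOver_mem_coverings n hn hR)
    rw [Sieve.generate_map_eq_functorPushforward, Sieve.functorPushforward_comp] at hR'
    exact (GrothendieckTopology.mem_over_iff _ _).2 hR'
  have h_restricted : CoverPreserving ((𝒢.siteOver n hn).restrictedTopology J) (𝒢.topology B)
      (𝒢.siteOver n hn ⋙ Over.forget _) :=
    .comp _ _ (.of_isContinuous (𝒢.siteOver n hn) _ J)
      ((𝒢.topology B).over_forget_coverPreserving _)
  exact ⟨fun hS => h_restricted.cover_preserve (h_le _ hS)⟩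

variable {n hn} in
theorem exists_isPushout_precompose {Y Z : 𝒢.EtaleGenerator B} (m : Y ⟶ Z)
    {d : 𝒢.EtaleGenerator C} (φ : Y ⟶ (𝒢.precompose n hn).obj d) :
    ∃ (q : 𝒢.EtaleGenerator C) (p : d ⟶ q) (r : Z ⟶ (𝒢.precompose n hn).obj q),
      IsPushout m.hom.right φ.hom.right r.hom.right p.hom.right := by
  let ψ : Y.obj.right ⟶ d.obj.right := φ.hom.right
  have h : IsPushout m.hom.right ψ _ _ := IsPushout.of_hasPushout m.hom.right ψ
  have hq : 𝒢.IsFPEtale C (Under.mk (d.obj.hom ≫ pushout.inr m.hom.right ψ)) :=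
    (𝒢.isFPEtale_iff _).2 (𝒢.𝒱.maps.pushouts.comp_mem _ _ ((𝒢.isFPEtale_iff _).1 d.property)
      (MorphismProperty.of_isPushout h.flip (pushouts_hom_right m)))
  have hr : Z.obj.hom ≫ pushout.inl m.hom.right ψ =
      n ≫ d.obj.hom ≫ pushout.inr m.hom.right ψ := by
    have hφ : Y.obj.hom ≫ ψ = n ≫ d.obj.hom := Under.w φ.hom
    rw [← Under.w m.hom, Category.assoc, h.w, reassoc_of% hφ]
  exact ⟨⟨_, hq⟩, ObjectProperty.homMk (Under.homMk (pushout.inr m.hom.right ψ) rfl),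
    ObjectProperty.homMk (Under.homMk (pushout.inl m.hom.right ψ) hr), h⟩

instance isCocontinuous_siteOver :
    (𝒢.siteOver n hn ⋙ Over.forget _).IsCocontinuous (𝒢.topology C) (𝒢.topology B) := by
  refine isCocontinuous_toGrothendieck fun {Y R} hR d φ => ?_
  obtain ⟨I, n', m, K, K', l, b, b', hl, h, rfl⟩ := hR
  choose q p r hpq using fun i => 𝒢.exists_isPushout_precompose (m i) φ.unop
  have h_mem : Presieve.ofArrows (fun i => op (q i)) (fun i => (p i).op) ∈ 𝒢.coverings C d :=
    ⟨I, q, p, K, K', l, b ≫ φ.unop.hom.right, fun i => b' i ≫ (r i).hom.right, hl,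
      fun i => (h i).paste_vert (hpq i), rfl⟩
  refine (𝒢.topology C).superset_covering ?_ (Precoverage.generate_mem_toGrothendieck h_mem)
  rw [Sieve.generate_le_iff]
  rintro _ _ ⟨i⟩
  refine ⟨_, (r i).op, (m i).op, ⟨i⟩, ?_⟩
  apply Quiver.Hom.unop_inj
  ext
  exact (hpq i).w

end Geometry

/-! ### The spectrum of an etale map -/

namespace Geometry

variable {ℬ : Type u} [Category.{w} ℬ] [IsLocallyFinitelyPresentable.{w} ℬ] (𝒢 : Geometry ℬ)
  {B C : ℬ} (n : B ⟶ C) (hn : 𝒢.IsFPEtale B (Under.mk n))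

/-- Presheaves on the spectral site of `C`, as the slice of presheaves on that of `B` over the
presheaf represented by `n`. -/
def overReprEquivalence : Over (𝒢.repr ⟨Under.mk n, hn⟩) ≌ 𝒢.PSh C :=
  (overYonedaRestrict (𝒢.siteOver n hn)).asEquivalence

/-- The spectrum of `C`, as the slice of the spectrum of `B` over the sheaf represented by `n`. -/
def overSheafReprEquivalence : Over (𝒢.sheafRepr ⟨Under.mk n, hn⟩) ≌ 𝒢.Spec C :=
  overSheafEquivalence (𝒢.siteOver n hn) (𝒢.coverPreserving_siteOver n hn)

/-- `overReprEquivalence` and `overSheafReprEquivalence` commute with sheafification. -/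
def postCompOverSheafReprEquivalence :
    Over.post (𝒢.ι B).inverse ⋙ (𝒢.overSheafReprEquivalence n hn).functor ≅
      (𝒢.overReprEquivalence n hn).functor ⋙ (𝒢.ι C).inverse :=
  postCompOverSheafEquivalence (𝒢.siteOver n hn) (𝒢.coverPreserving_siteOver n hn)

/-- The geometric morphism `Spec(C) ⟶ Spec(B)` given by the slice over the sheaf represented by
`n`. -/
def etaleSpec : GeometricMorphism (𝒢.Spec C) (𝒢.Spec B) :=
  (GeometricMorphism.ofEquivalence (𝒢.overSheafReprEquivalence n hn).symm).comp
    (GeometricMorphism.etale (𝒢.sheafRepr ⟨Under.mk n, hn⟩))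

/-- The product of the presheaves represented by `m` and `n` is, as a presheaf on the spectral site
of `C`, represented by the pushout of `m` along `n`. -/
def yonedaCompStarCompOverReprEquivalence :
    yoneda ⋙ Over.star (𝒢.repr ⟨Under.mk n, hn⟩) ⋙ (𝒢.overReprEquivalence n hn).functor ≅
      (𝒢.push n).op ⋙ yoneda :=
  yonedaCompStarIso (𝒢.siteOver n hn) (𝒢.pushAdjPrecompose n hn).op

/-- The inverse image of `etaleSpec` extends the pushout functor `(𝒢.push n).op`. -/
def genericCompEtaleSpec :
    (𝒢.push n).op ⋙ 𝒢.generic C ≅ 𝒢.generic B ⋙ (𝒢.etaleSpec n hn).inverse :=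
  have := (𝒢.ι B).preservesFiniteLimits
  Functor.isoWhiskerRight (𝒢.yonedaCompStarCompOverReprEquivalence n hn).symm (𝒢.ι C).inverse ≪≫
    Functor.isoWhiskerLeft (yoneda ⋙ Over.star (𝒢.repr ⟨Under.mk n, hn⟩))
      (𝒢.postCompOverSheafReprEquivalence n hn).symm ≪≫
    Functor.isoWhiskerLeft yoneda (Functor.isoWhiskerRight
      (starCompPostIso (𝒢.ι B).inverse (𝒢.repr ⟨Under.mk n, hn⟩))
      (𝒢.overSheafReprEquivalence n hn).functor)

theorem isSpecMap_etaleSpec : 𝒢.IsSpecMap n (𝒢.etaleSpec n hn) := by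
  have : (𝒢.etaleSpec n hn).inverse.IsLeftAdjoint := (𝒢.etaleSpec n hn).adj.isLeftAdjoint
  have : (𝒢.ι B).direct.Full := inferInstanceAs (sheafToPresheaf _ _).Full
  have : (𝒢.ι B).direct.Faithful := inferInstanceAs (sheafToPresheaf _ _).Faithful
  have : (𝒢.etaleSpec n hn).inverse.IsLeftKanExtension
      (𝟙 (𝒢.generic B ⋙ (𝒢.etaleSpec n hn).inverse)) :=
    isLeftKanExtension_yoneda_comp (𝒢.ι B).adj (𝒢.etaleSpec n hn).inverse
  exact ⟨Functor.leftKanExtensionUniqueOfIso _ (𝟙 (𝒢.generic B ⋙ (𝒢.etaleSpec n hn).inverse))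
    (𝒢.genericCompEtaleSpec n hn).symm
    ((𝒢.generic B).leftKanExtension ((𝒢.push n).op ⋙ 𝒢.generic C))
    ((𝒢.generic B).leftKanExtensionUnit ((𝒢.push n).op ⋙ 𝒢.generic C))⟩

end Geometry

end

theorem mainTheorem11 {ℬ : Type u} [Category.{w} ℬ]
    [IsLocallyFinitelyPresentable.{w} ℬ] (𝒢 : Geometry ℬ) {B C : ℬ} (n : B ⟶ C)
    (hn : 𝒢.IsFPEtale B (Under.mk n)) :
    (∃ specn : GeometricMorphism (𝒢.Spec C) (𝒢.Spec B), 𝒢.IsSpecMap n specn) ∧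
    (∀ specn : GeometricMorphism (𝒢.Spec C) (𝒢.Spec B), 𝒢.IsSpecMap n specn →
      specn.IsEtale ∧
      ∃ e : 𝒢.Spec C ≌ Over (𝒢.sheafRepr ⟨Under.mk n, hn⟩),
        Nonempty (specn ≅ (GeometricMorphism.ofEquivalence e).comp
          (GeometricMorphism.etale (𝒢.sheafRepr ⟨Under.mk n, hn⟩))) ∧
        ∃ β : ((GeometricMorphism.ofEquivalence e).comp
              ((𝒢.ι B).slice (𝒢.repr ⟨Under.mk n, hn⟩))).comp
                (GeometricMorphism.etale (𝒢.repr ⟨Under.mk n, hn⟩)) ≅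
            specn.comp (𝒢.ι B),
          GeometricMorphism.IsTwoPullback.{w, v₁, u₁} β) ∧
    IsGrothendieckTopos.{w} (Over (𝒢.sheafRepr ⟨Under.mk n, hn⟩)) ∧
    IsGrothendieckTopos.{w} (Over (𝒢.repr ⟨Under.mk n, hn⟩)) ∧
    ∃ α : ((𝒢.ι B).slice (𝒢.repr ⟨Under.mk n, hn⟩)).comp
          (GeometricMorphism.etale (𝒢.repr ⟨Under.mk n, hn⟩)) ≅
        (GeometricMorphism.etale (𝒢.sheafRepr ⟨Under.mk n, hn⟩)).comp (𝒢.ι B),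
      GeometricMorphism.IsTwoPullback.{w, v₁, u₁} α := by
  have hα : GeometricMorphism.IsTwoPullback.{w, v₁, u₁}
      (GeometricMorphism.sliceEtaleIso (𝒢.ι B) (𝒢.repr ⟨Under.mk n, hn⟩)) :=
    GeometricMorphism.isTwoPullback_sliceEtaleIso _ _
  refine ⟨⟨_, 𝒢.isSpecMap_etaleSpec n hn⟩, fun specn hspecn => ?_,
    .of_equivalence (𝒢.overSheafReprEquivalence n hn),
    .of_equivalence (𝒢.overReprEquivalence n hn), _, hα⟩
  obtain ⟨i⟩ := hspecn
  obtain ⟨j⟩ := 𝒢.isSpecMap_etaleSpec n hn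
  let θ : specn ≅ 𝒢.etaleSpec n hn := GeometricMorphism.isoMk (i ≪≫ j.symm)
  exact ⟨⟨_, _, ⟨θ⟩⟩, _, ⟨θ⟩, GeometricMorphism.IsTwoPullback.of_equivalence hα _ θ⟩
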